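/- **Setting.** Let $0<s\le 1$. *Parallelograms and lattices.* Let $v_s=(-1-\frac s2,-\frac{\sqrt3 s}{2})$ and let $$a_0=(2,0),\quad a_1=(-1,\sqrt3),\quad a_2=(-1,-\sqrt3),\qquad b_0=s(1,\sqrt3),\quad b_1=s(-2,0),\quad b_2=s(1,-\sqrt3).$$ For $i\in\{0,1,2\}$ (indices mod 3) let $F_i=\{v_s+\alpha a_i+\beta b_i:\ 0\le\alpha,\beta\le 1\}$ and $L_i=\mathbb Z b_i+\mathbb Z a_{i+1}$. (Take the parallelogram $F_0$ with sides $(2,0)$ and $(s,\sqrt3 s)$, centered at the origin. Its six images under the dihedral group of order 6 generated by the reflections in the lines of directions $0,\pi/3,2\pi/3$ through its lower left vertex $v_s$ are, counterclockwise, the parallelograms labelled $F_0,L_0,F_1,L_1,F_2,L_2$; the lattice $L_i$ is generated by the sides of the parallelogram labelled $L_i$. Both $F_i$ and $F_{i+1}$ are fundamental domains of $L_i$.) *The map $f'_s$.* Put $X_s=F_0$. For $p\in F_i$ let $g_s(p)=p+V\in F_{i+1}$ with $V\in L_i$, which is defined if and only if there is exactly one such $V$. Let $f'_s=g_s\circ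 g_s\circ g_s$, a partially defined map from $X_s=F_0$ (via $F_1$ and $F_2$) to $X_s$. *Cut and paste.* Let $w=2-2\lfloor 1/s\rfloor s$, and let $P_s\subset X_s$ be the left part of $X_s$, that is, the (possibly degenerate) parallelogram with corner $v_s$ and sides $(w,0)$ and $(s,\sqrt3 s)$. The operation $\mathcal{OP}_s$ maps $p$ to $p+(2-w,0)$ if $p$ is in the interior of $P_s$, and to $p-(w,0)$ if $p$ is in the interior of $X_s\setminus P_s$. The *triple lattice PET* is the partially defined map $f_s=\mathcal{OP}_s\circ f'_s\circ\mathcal{OP}_s^{-1}$ on $X_s$. It is defined at almost every point of $X_s$. *First return.* For $Y\subset X_s$ the first return map $f_s|_Y$ sends $p\in Y$ to $f_s^n(p)$, where $n\ge 1$ is the least positive integer with $f_s^n(p)\in Y$; it is defined at $p$ if the iterates $f_s(p),\dots,f_s^n(p)$ are defined for such an $n$. *Renormalization map.* For $s\in(0,1)$ let $R_1(s)=\dfrac{s}{1+s-s\lfloor 1/s\rfloor}$, $R_2(s)=\dfrac{1-s}{s}$, and $$R(s)=\begin{cases}R_1(s)& 0<s<\frac12,\\ R_2(s)&\frac12\le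 s<\frac23,\\ R_1(R_2(s))&\frac23\le s<1.\end{cases}$$ Then $R(s)\in(0,1]$. **Theorem (Renormalization).** Let $s\in(0,1)$ and $t=R(s)$. There are a proper subset $Y_s\subsetneq X_s$ and a similarity $\psi_s$ of the plane with $\psi_s(Y_s)=X_t$ such that the first return map of $f_s$ to $Y_s$ satisfies $$f_s|_{Y_s}=\psi_s^{-1}\circ f_t\circ\psi_s .$$ Precisely: both sides are defined at almost every point of $Y_s$ (with respect to Lebesgue measure), and they agree at every point of $Y_s$ at which both are defined. -/

import Mathlib

namespace TripleLattice

/-- The Euclidean plane. -/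
abbrev Plane := EuclideanSpace ℝ (Fin 2)

/-- The closed parallelogram with corner `c` and sides `u`, `v`. -/
def parallelogram (c u v : Plane) : Set Plane :=
  {p | ∃ α ∈ Set.Icc (0 : ℝ) 1, ∃ β ∈ Set.Icc (0 : ℝ) 1, p = c + α • u + β • v}

/-- The sides of length `2` of the parallelograms `F₀, F₁, F₂`
(directions `0`, `2π/3`, `4π/3`). -/
noncomputable def long : Fin 3 → Plane :=
  ![!₂[2, 0], !₂[-1, Real.sqrt 3], !₂[-1, -Real.sqrt 3]]

/-- The sides of length `2 s` of the parallelograms `F₀, F₁, F₂`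
(directions `π/3`, `π`, `5π/3`). -/
noncomputable def short (s : ℝ) : Fin 3 → Plane :=
  ![!₂[s, Real.sqrt 3 * s], !₂[-2 * s, 0], !₂[s, -(Real.sqrt 3 * s)]]

/-- The common corner of `F₀, F₁, F₂`, chosen such that `F₀` is centered at the origin; it is the
lower left vertex of `F₀`. -/
noncomputable def corner (s : ℝ) : Plane := !₂[-1 - s / 2, -(Real.sqrt 3 * s / 2)]

/-- The parallelograms `F₀, F₁, F₂`. The six images of `F₀` under the dihedral group of order six
generated by the reflections in the three lines through `corner s` of directions `0`, `π/3`, `2π/3`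
fill the six sectors of angle `π/3` at `corner s`; counterclockwise, from `F₀` on, they
are labelled `F₀, L₀, F₁, L₁, F₂, L₂`. -/
noncomputable def F (s : ℝ) (i : Fin 3) : Set Plane :=
  parallelogram (corner s) (long i) (short s i)

/-- The lattice `Lᵢ`, generated by the sides of the parallelogram labelled `Lᵢ`, which lies between
`Fᵢ` and `Fᵢ₊₁` (indices mod 3) and shares the side `short s i` with `Fᵢ` and the side
`long (i + 1)` with `Fᵢ₊₁`. -/
noncomputable def L (s : ℝ) (i : Fin 3) : AddSubgroup Plane :=
  AddSubgroup.closure {short s i, long (i + 1)}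

/-- The phase space `X_s = F₀` of the triple lattice PET. -/
noncomputable def X (s : ℝ) : Set Plane := F s 0

/-- `LatticeStep s i p q`: the map `g_s` from `Fᵢ` to `Fᵢ₊₁` is defined at `p` and takes the
value `q`, that is, `p ∈ Fᵢ`, there is exactly one `V ∈ Lᵢ` with `p + V ∈ Fᵢ₊₁`, and
`q = p + V`. -/
def LatticeStep (s : ℝ) (i : Fin 3) (p q : Plane) : Prop :=
  p ∈ F s i ∧ (∃! V : Plane, V ∈ L s i ∧ p + V ∈ F s (i + 1)) ∧ q - p ∈ L s i ∧ q ∈ F s (i + 1)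

/-- `CubeStep s p q`: the map `f'_s = (g_s)³ : X_s → X_s` is defined at `p` and takes the
value `q`. -/
def CubeStep (s : ℝ) (p q : Plane) : Prop :=
  ∃ a b : Plane, LatticeStep s 0 p a ∧ LatticeStep s 1 a b ∧ LatticeStep s 2 b q

/-- The width `2 - 2 ⌊1/s⌋ s` of the part of `X_s` that is cut off. -/
noncomputable def cutWidth (s : ℝ) : ℝ := 2 - 2 * (⌊1 / s⌋ : ℝ) * s

/-- The part of `X_s` that is cut off: the left part, of width `cutWidth s`. It is a segment if
`cutWidth s = 0`. -/
noncomputable def cutPart (s : ℝ) : Set Plane :=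
  parallelogram (corner s) !₂[cutWidth s, 0] (short s 0)

/-- `CutPaste s p q`: the cut-and-paste operation on `X_s` is defined at `p` and takes the value
`q`. The left part of `X_s` is moved to the right end, the rest is moved to the left end;
boundary points of the two parts are left out. -/
def CutPaste (s : ℝ) (p q : Plane) : Prop :=
  (p ∈ interior (cutPart s) ∧ q = p + !₂[2 - cutWidth s, 0]) ∨
    (p ∈ interior (X s \ cutPart s) ∧ q = p - !₂[cutWidth s, 0])

/-- `PETStep s p q`: the triple lattice PET `f_s` is defined at `p` and takes the value `q`. The
map `f_s` is the conjugate of `f'_s` by the cut-and-paste operation. -/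
def PETStep (s : ℝ) (p q : Plane) : Prop :=
  ∃ p' q' : Plane, CutPaste s p' p ∧ CubeStep s p' q' ∧ CutPaste s q' q

/-- `FirstReturn f Y p q`, for a partial map given by its graph `f`: the first return map to `Y` is
defined at `p ∈ Y` and takes the value `q`, that is, `q = fⁿ(p)` where `n` is the least positive
integer with `fⁿ(p) ∈ Y`. -/
def FirstReturn (f : Plane → Plane → Prop) (Y : Set Plane) (p q : Plane) : Prop :=
  p ∈ Y ∧ q ∈ Y ∧ ∃ (n : ℕ) (o : ℕ → Plane), 0 < n ∧ o 0 = p ∧ o n = q ∧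
    (∀ k < n, f (o k) (o (k + 1))) ∧ ∀ k, 0 < k → k < n → o k ∉ Y

noncomputable def R₁ (s : ℝ) : ℝ := s / (1 + s - s * (⌊1 / s⌋ : ℝ))

noncomputable def R₂ (s : ℝ) : ℝ := (1 - s) / s

/-- The renormalization map, for `s ∈ (0, 1)`. -/
noncomputable def R (s : ℝ) : ℝ :=
  if s < 1 / 2 then R₁ s else if s < 2 / 3 then R₂ s else R₁ (R₂ s)

end TripleLattice

/-! ### The map in coordinates and the itineraries of its first returns -/

namespace TripleLattice

/-! In coordinates along the sides of `X s`, in units of length 2, each lattice step is a linear map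
of order three followed by a reduction modulo the sides. Three steps and the two shifts therefore
make a piecewise translation, `Pet s 1 ⌊1 / s⌋`, with translation vectors in (ℤs + ℤ)². For sides `a
≤ b ≤ 2 * a` and shift number 1 it has the eleven pieces of `Step a b`.

Three reductions of the pair (a, b) carry the proof. Each follows every piece of the smaller map
through the larger one. (1) `ret_of_step_cut`: if n = ⌊b/a⌋ ≥ 2, the return to the right part of
width b - (n-1)a is the map of sides (a, b - (n-1)a). This settles s ≤ 1/2. (2) `ret_of_step_flip`:
if 3a < 2b ≤ 4a, the return to the left part of width b - a is, after a reflection, the map of sides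
(b-a, a). (3) `ret_of_step_glue`: if 2b ≤ 3a, removing two strips of width b - a and gluing gives
the map of sides (2a-b, a). For s > 1/2, (3) is applied until (2) is available; b - a never changes,
so the number of gluings is ⌊s/(1-s)⌋ - 1.

All this holds off countably many lines (`Irreg`), hence almost everywhere. Agreement at the
remaining points where both sides are defined follows by perturbation (`ret_agree`). -/

/-- The first return to `Y` under a relation `f`. -/
inductive Ret {α : Type*} (f : α → α → Prop) (Y : Set α) : α → α → Prop
  | last {p q : α} : f p q → q ∈ Y → Ret f Y p q
  | cons {p q r : α} : f p q → q ∉ Y → Ret f Y q r → Ret f Y p r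

/-- A step between consecutive parallelograms of sides `b` and `a`, in the coordinates given by the
sides. -/
def Turn (a b : ℝ) (p q : ℝ × ℝ) : Prop :=
  (q.1 ∈ Set.Ioo 0 b ∧ q.2 ∈ Set.Ioo 0 a) ∧
    (∃ k : ℤ, q.2 = -(p.1 + p.2) + k * a) ∧ ∃ m : ℤ, q.1 = -p.1 - q.2 + m * b

/-- Translation by `n * a` modulo `b` in the first coordinate. -/
def Shift (a b : ℝ) (n : ℤ) (p q : ℝ × ℝ) : Prop :=
  (p.1 ∈ Set.Ioo 0 b ∧ p.2 ∈ Set.Ioo 0 a) ∧ q.1 ∈ Set.Ioo 0 b ∧ q.2 = p.2 ∧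
    ∃ j : ℤ, q.1 = p.1 + n * a + j * b

/-- The triple lattice map on a parallelogram of sides `b` and `a`, in coordinates. -/
def Pet (a b : ℝ) (n : ℤ) (p q : ℝ × ℝ) : Prop :=
  ∃ u v w z, Shift a b n u p ∧ Turn a b u v ∧ Turn a b v w ∧ Turn a b w z ∧ Shift a b n z q

/-- Once the integers are chosen (`i` and `j` for the two shifts, `kᵣ` and `mᵣ` for the r-th turn),
a value of the map is certified by linear inequalities alone. -/
theorem pet_of_branches {a b : ℝ} {n : ℤ} {x h x' h' : ℝ} (i k₁ m₁ k₂ m₂ k₃ m₃ j : ℤ)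
    (hx' : x' = x + (k₂ - k₃) * a + (i + m₃ - m₁ + j) * b)
    (hh' : h' = h + (k₃ - k₁) * a + (m₁ - m₂) * b)
    (x0 : 0 < x) (xb : x < b) (h0 : 0 < h) (ha : h < a)
    (u0 : 0 < x - n * a + i * b) (ub : x - n * a + i * b < b)
    (c₁ : 0 < k₁ * a - (x - n * a + i * b) - h) (d₁ : k₁ * a - (x - n * a + i * b) - h < a)
    (e₁ : 0 < h - k₁ * a + m₁ * b) (f₁ : h - k₁ * a + m₁ * b < b)
    (c₂ : 0 < x - n * a + i * b - m₁ * b + k₂ * a)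
    (d₂ : x - n * a + i * b - m₁ * b + k₂ * a < a)
    (e₂ : 0 < (k₁ - k₂) * a + m₂ * b - h - (x - n * a + i * b))
    (f₂ : (k₁ - k₂) * a + m₂ * b - h - (x - n * a + i * b) < b)
    (c₃ : 0 < h') (d₃ : h' < a)
    (e₃ : 0 < x - n * a + i * b + (k₂ - k₃) * a + (m₃ - m₁) * b)
    (f₃ : x - n * a + i * b + (k₂ - k₃) * a + (m₃ - m₁) * b < b)
    (g₀ : 0 < x') (g₁ : x' < b) :
    Pet a b n (x, h) (x', h') := by
  refine ⟨(x - n * a + i * b, h),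
    (h - k₁ * a + m₁ * b, k₁ * a - (x - n * a + i * b) - h),
    ((k₁ - k₂) * a + m₂ * b - h - (x - n * a + i * b), x - n * a + i * b - m₁ * b + k₂ * a),
    (x - n * a + i * b + (k₂ - k₃) * a + (m₃ - m₁) * b, h'),
    ⟨⟨⟨u0, ub⟩, h0, ha⟩, ⟨x0, xb⟩, rfl, -i, ?_⟩,
    ⟨⟨⟨e₁, f₁⟩, c₁, d₁⟩, ⟨k₁, ?_⟩, m₁, ?_⟩,
    ⟨⟨⟨e₂, f₂⟩, c₂, d₂⟩, ⟨k₂, ?_⟩, m₂, ?_⟩,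
    ⟨⟨⟨e₃, f₃⟩, c₃, d₃⟩, ⟨k₃, ?_⟩, m₃, ?_⟩,
    ⟨⟨⟨e₃, f₃⟩, c₃, d₃⟩, ⟨g₀, g₁⟩, rfl, j, ?_⟩⟩
  all_goals push_cast
  all_goals first | ring1 | linear_combination hh' | linear_combination -hh' | linear_combination hx'

/-- For `a ≤ b ≤ 2 a` the triple lattice map is a piecewise translation with eleven pieces. -/
inductive Step (a b : ℝ) : ℝ × ℝ → ℝ × ℝ → Prop
  | lowFix {x h : ℝ} : 0 < x → 0 < h → x + h < 2 * a - b → Step a b (x, h) (x, h)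
  | right {x h : ℝ} : 0 < x → x < a → x ≠ 2 * a - b → 2 * a - b < h → h < a →
      x + h < 3 * a - b → Step a b (x, h) (x + (b - a), h)
  | upLeft {x h : ℝ} : 0 < h → h < 2 * a - b → b - a < x → 2 * a - b < x + h → x + h < a →
      Step a b (x, h) (x - (b - a), h + (b - a))
  | midFix {x h : ℝ} : h < 2 * a - b → x < a → a < x + h → Step a b (x, h) (x, h)
  | far {x h : ℝ} : 0 < x → x < b - a → 0 < h → h < 2 * a - b → 2 * a - b < x + h →
      Step a b (x, h) (x + a, h)
  | dropLeft {x h : ℝ} : b - a < x → x < a → 2 * a - b < h → h < a → 3 * a - b < x + h →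
      Step a b (x, h) (x - (b - a), h - (2 * a - b))
  | topFix {x h : ℝ} : 0 < x → x < b - a → 2 * a - b < h → h < a → 3 * a - b < x + h →
      Step a b (x, h) (x, h)
  | left {x h : ℝ} : a < x → 0 < h → x + h < b → Step a b (x, h) (x - (b - a), h)
  | down {x h : ℝ} : a < x → x < b → b - a < h → b < x + h → x + h < 2 * a →
      Step a b (x, h) (x, h - (b - a))
  | wrap {x h : ℝ} : a < x → x < b → h < b - a → b < x + h → x + h < 2 * a →
      Step a b (x, h) (x - a, h + (2 * a - b))
  | endFix {x h : ℝ} : x < b → h < a → 2 * a < x + h → Step a b (x, h) (x, h)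

theorem Step.pet {a b : ℝ} (hab : a ≤ b) (hba : b ≤ 2 * a) {p q : ℝ × ℝ} (h : Step a b p q) :
    Pet a b 1 p q := by
  cases h with
  | lowFix => apply pet_of_branches 1 1 1 1 1 1 1 (-1) <;> push_cast <;> linarith
  | right _ _ hne =>
    -- The third turn wraps differently on the two sides of this line and lands on the boundary on
    -- it; the final shift makes the two translations equal.
    rcases lt_or_gt_of_ne hne with hx | hx
    · apply pet_of_branches 1 2 1 1 1 2 2 (-1) <;> push_cast <;> linarith
    · apply pet_of_branches 1 2 1 1 1 2 1 0 <;> push_cast <;> linarith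
  | upLeft => apply pet_of_branches 1 2 2 2 1 1 1 (-1) <;> push_cast <;> linarith
  | midFix => apply pet_of_branches 1 2 2 2 2 2 2 (-1) <;> push_cast <;> linarith
  | far => apply pet_of_branches 1 2 2 3 2 2 1 0 <;> push_cast <;> linarith
  | dropLeft => apply pet_of_branches 1 3 2 2 1 1 1 (-1) <;> push_cast <;> linarith
  | topFix => apply pet_of_branches 1 3 2 3 2 3 2 (-1) <;> push_cast <;> linarith
  | left => apply pet_of_branches 0 1 1 2 1 1 1 (-1) <;> push_cast <;> linarith
  | down => apply pet_of_branches 0 1 1 2 2 2 1 0 <;> push_cast <;> linarith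
  | wrap => apply pet_of_branches 0 1 1 2 2 3 2 (-1) <;> push_cast <;> linarith
  | endFix => apply pet_of_branches 0 2 1 2 1 2 1 0 <;> push_cast <;> linarith

/-- The bounds on `a` and `b` put the new sides `b - a` and `a` again in the range where `Step`
describes the map. `g₁` and `g₂` keep the orbit off the line where `Step.right` is undefined. -/
theorem ret_of_step_flip {a b x h : ℝ} {q' : ℝ × ℝ} (hba : b ≤ 2 * a)
    (h32 : 3 * a < 2 * b) (g₁ : x ≠ 2 * a - b) (g₂ : x + (b - a) ≠ 2 * a - b)
    (hs : Step (b - a) a (a - h, b - a - x) q') :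
    ∃ q, q' = (a - q.2, b - a - q.1) ∧ Ret (Step a b) {p | p.1 ≤ b - a} (x, h) q := by
  -- One itinerary for each piece of the small map, in the order of the constructors.
  cases hs <;> [
    refine ⟨_, ?_, .last (.topFix ?_ ?_ ?_ ?_ ?_) ?_⟩;
    refine ⟨_, ?_, .cons (.right ?_ ?_ g₁ ?_ ?_ ?_) ?_ (.last (.dropLeft ?_ ?_ ?_ ?_ ?_) ?_)⟩;
    refine ⟨_, ?_, .cons (.right ?_ ?_ g₁ ?_ ?_ ?_) ?_ (.last (.wrap ?_ ?_ ?_ ?_ ?_) ?_)⟩;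
    refine ⟨_, ?_, .cons (.right ?_ ?_ g₁ ?_ ?_ ?_) ?_ (.last (.left ?_ ?_ ?_) ?_)⟩;
    refine ⟨_, ?_, .cons (.right ?_ ?_ g₁ ?_ ?_ ?_) ?_ (.cons (.down ?_ ?_ ?_ ?_ ?_) ?_
      (.last (.left ?_ ?_ ?_) ?_))⟩;
    refine ⟨_, ?_, .cons (.right ?_ ?_ g₁ ?_ ?_ ?_) ?_ (.cons (.right ?_ ?_ g₂ ?_ ?_ ?_) ?_
      (.last (.wrap ?_ ?_ ?_ ?_ ?_) ?_))⟩;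
    refine ⟨_, ?_, .cons (.right ?_ ?_ g₁ ?_ ?_ ?_) ?_ (.cons (.right ?_ ?_ g₂ ?_ ?_ ?_) ?_
      (.cons (.down ?_ ?_ ?_ ?_ ?_) ?_ (.cons (.left ?_ ?_ ?_) ?_
      (.last (.upLeft ?_ ?_ ?_ ?_ ?_) ?_))))⟩;
    refine ⟨_, ?_, .cons (.far ?_ ?_ ?_ ?_ ?_) ?_ (.last (.wrap ?_ ?_ ?_ ?_ ?_) ?_)⟩;
    refine ⟨_, ?_, .cons (.far ?_ ?_ ?_ ?_ ?_) ?_ (.last (.left ?_ ?_ ?_) ?_)⟩;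
    refine ⟨_, ?_, .cons (.far ?_ ?_ ?_ ?_ ?_) ?_ (.cons (.left ?_ ?_ ?_) ?_
      (.last (.upLeft ?_ ?_ ?_ ?_ ?_) ?_))⟩;
    refine ⟨_, ?_, .last (.lowFix ?_ ?_ ?_) ?_⟩]
  all_goals first
    | linarith
    | exact Prod.ext (by ring) (by ring)
    | (simp only [Set.mem_ofPred_eq, not_le]; linarith)

/-- The part of the parallelogram of sides `b`, `a` that is kept when two strips of width `b - a`
are removed. -/
def kept (a b : ℝ) : Set (ℝ × ℝ) := {p | (p.1 ≤ 2 * a - b ∨ a ≤ p.1) ∧ b - a ≤ p.2}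

/-- Gluing the kept part along the removed strips. -/
def Glue (a b : ℝ) (p p' : ℝ × ℝ) : Prop :=
  (p.1 < 2 * a - b ∧ p' = (p.1, p.2 - (b - a))) ∨
    (a < p.1 ∧ p' = (p.1 - (b - a), p.2 - (b - a)))

/-- `h32` says exactly that the new sides satisfy `a ≤ 2 * (2 * a - b)`. A piece whose image enters
a removed strip is followed until it comes out; the translations made on the way add up to the one
seen after gluing. -/
theorem ret_of_step_glue {a b : ℝ} {p p' q' : ℝ × ℝ} (hab : a < b) (h32 : 2 * b ≤ 3 * a)
    (g : p.1 + (b - a) ≠ 2 * a - b) (hp : Glue a b p p') (hs : Step (2 * a - b) a p' q') :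
    ∃ q, Glue a b q q' ∧ Ret (Step a b) (kept a b) p q := by
  obtain ⟨x, h⟩ := p
  rcases hp with ⟨hx, rfl⟩ | ⟨hx, rfl⟩ <;> dsimp only at g hx hs
  · rcases hs
    case right =>
      rcases lt_or_gt_of_ne g with hlt | hgt
      · refine ⟨_, .inl ⟨?_, ?_⟩, .last (.right ?_ ?_ hx.ne ?_ ?_ ?_) ⟨.inl ?_, ?_⟩⟩
        all_goals first | linarith | exact Prod.ext (by ring) (by ring)
      -- The image falls into the removed vertical strip, and a second `right` crosses it.
      · refine ⟨_, .inr ⟨?_, ?_⟩, .cons (.right ?_ ?_ hx.ne ?_ ?_ ?_) ?_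
          (.last (.right ?_ ?_ hgt.ne' ?_ ?_ ?_) ⟨.inr ?_, ?_⟩)⟩
        rotate_left 7
        · rintro ⟨h1 | h1, -⟩ <;> linarith
        all_goals first | linarith | exact Prod.ext (by ring) (by ring)
    all_goals first
      | (exfalso; linarith)
      | skip
    · refine ⟨_, .inl ⟨?_, ?_⟩, .last (.lowFix ?_ ?_ ?_) ⟨.inl ?_, ?_⟩⟩
      all_goals first | linarith | exact Prod.ext (by ring) (by ring)
    · refine ⟨_, .inl ⟨?_, ?_⟩, .last (.upLeft ?_ ?_ ?_ ?_ ?_) ⟨.inl ?_, ?_⟩⟩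
      all_goals first | linarith | exact Prod.ext (by ring) (by ring)
    · refine ⟨_, .inl ⟨?_, ?_⟩, .last (.midFix ?_ ?_ ?_) ⟨.inl ?_, ?_⟩⟩
      all_goals first | linarith | exact Prod.ext (by ring) (by ring)
    · refine ⟨_, .inr ⟨?_, ?_⟩, .last (.far ?_ ?_ ?_ ?_ ?_) ⟨.inr ?_, ?_⟩⟩
      all_goals first | linarith | exact Prod.ext (by ring) (by ring)
    · refine ⟨_, .inl ⟨?_, ?_⟩, .cons (.right ?_ ?_ hx.ne ?_ ?_ ?_) (fun h => ?_)
        (.cons (.dropLeft ?_ ?_ ?_ ?_ ?_) (fun h => ?_)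
        (.last (.upLeft ?_ ?_ ?_ ?_ ?_) ⟨.inl ?_, ?_⟩))⟩
      all_goals first
        | linarith
        | exact Prod.ext (by ring) (by ring)
        | linarith [h.2]
        | (rcases h.1 with h1 | h1 <;> linarith)
    · refine ⟨_, .inl ⟨?_, ?_⟩, .cons (.right ?_ ?_ hx.ne ?_ ?_ ?_) (fun h => ?_)
        (.cons (.dropLeft ?_ ?_ ?_ ?_ ?_) (fun h => ?_)
        (.cons (.far ?_ ?_ ?_ ?_ ?_) (fun h => ?_)
        (.last (.wrap ?_ ?_ ?_ ?_ ?_) ⟨.inl ?_, ?_⟩)))⟩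
      all_goals first
        | linarith
        | exact Prod.ext (by ring) (by ring)
        | linarith [h.2]
        | (rcases h.1 with h1 | h1 <;> linarith)
  · rcases hs
    all_goals first
      | (exfalso; linarith)
      | skip
    · refine ⟨_, .inl ⟨?_, ?_⟩, .cons (.down ?_ ?_ ?_ ?_ ?_) (fun h => ?_)
        (.cons (.left ?_ ?_ ?_) (fun h => ?_)
        (.last (.upLeft ?_ ?_ ?_ ?_ ?_) ⟨.inl ?_, ?_⟩))⟩
      all_goals first
        | linarith
        | exact Prod.ext (by ring) (by ring)
        | linarith [h.2]
    · refine ⟨_, .inr ⟨?_, ?_⟩, .last (.down ?_ ?_ ?_ ?_ ?_) ⟨.inr ?_, ?_⟩⟩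
      all_goals first | linarith | exact Prod.ext (by ring) (by ring)
    · refine ⟨_, .inl ⟨?_, ?_⟩, .cons (.down ?_ ?_ ?_ ?_ ?_) (fun h => ?_)
        (.last (.wrap ?_ ?_ ?_ ?_ ?_) ⟨.inl ?_, ?_⟩)⟩
      all_goals first
        | linarith
        | exact Prod.ext (by ring) (by ring)
        | linarith [h.2]
    · refine ⟨_, .inr ⟨?_, ?_⟩, .last (.endFix ?_ ?_ ?_) ⟨.inr ?_, ?_⟩⟩
      all_goals first | linarith | exact Prod.ext (by ring) (by ring)

/-- Nine pieces return at once. The pieces `lowFix` and `endFix` consist of points of period two,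
which spend one step outside the right part. -/
theorem ret_of_step_cut {a b : ℝ} {n : ℤ} {p q : ℝ × ℝ} (ha : 0 < a) (hn : 2 ≤ n)
    (hlo : n * a ≤ b) (hhi : b < (n + 1) * a) (hs : Step a (b - (n - 1) * a) p q) :
    Ret (Pet a b n) {p | (n - 1) * a ≤ p.1} (p.1 + (n - 1) * a, p.2)
      (q.1 + (n - 1) * a, q.2) := by
  have h2a : 2 * a ≤ n * a := by gcongr; exact_mod_cast hn
  cases hs with
  | @lowFix x h =>
    refine .cons (q := (x, h)) ?_ ?_ (.last ?_ ?_)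
    · apply pet_of_branches 1 n 1 1 1 n 1 (-1) <;> push_cast <;> linarith
    · simp only [Set.mem_ofPred_eq, not_le]; linarith
    · apply pet_of_branches 1 1 1 n 1 1 1 (-1) <;> push_cast <;> linarith
    · simp only [Set.mem_ofPred_eq]; linarith
  | @right x _ _ _ hne =>
    refine .last ?_ ?_
    · rcases lt_or_gt_of_ne hne with hx | hx
      · apply pet_of_branches 1 (n + 1) 1 1 1 (n + 1) 2 (-1) <;> push_cast <;> linarith
      · apply pet_of_branches 1 (n + 1) 1 1 1 (n + 1) 1 0 <;> push_cast <;> linarith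
    · simp only [Set.mem_ofPred_eq]; linarith
  | upLeft =>
    refine .last ?_ ?_
    · apply pet_of_branches 1 (n + 1) 2 (n + 1) 1 1 1 (-1) <;> push_cast <;> linarith
    · simp only [Set.mem_ofPred_eq]; linarith
  | midFix =>
    refine .last ?_ ?_
    · apply pet_of_branches 1 (n + 1) 2 (n + 1) 2 (n + 1) 2 (-1) <;> push_cast <;> linarith
    · simp only [Set.mem_ofPred_eq]; linarith
  | far =>
    refine .last ?_ ?_
    · apply pet_of_branches 1 (n + 1) 2 (n + 2) 2 (n + 1) 1 0 <;> push_cast <;> linarith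
    · simp only [Set.mem_ofPred_eq]; linarith
  | dropLeft =>
    refine .last ?_ ?_
    · apply pet_of_branches 1 (n + 2) 2 (n + 1) 1 1 1 (-1) <;> push_cast <;> linarith
    · simp only [Set.mem_ofPred_eq]; linarith
  | topFix =>
    refine .last ?_ ?_
    · apply pet_of_branches 1 (n + 2) 2 (n + 2) 2 (n + 2) 2 (-1) <;> push_cast <;> linarith
    · simp only [Set.mem_ofPred_eq]; linarith
  | left =>
    refine .last ?_ ?_
    · apply pet_of_branches 0 1 1 (n + 1) 1 1 1 (-1) <;> push_cast <;> linarith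
    · simp only [Set.mem_ofPred_eq]; linarith
  | down =>
    refine .last ?_ ?_
    · apply pet_of_branches 0 1 1 (n + 1) 2 (n + 1) 1 0 <;> push_cast <;> linarith
    · simp only [Set.mem_ofPred_eq]; linarith
  | wrap =>
    refine .last ?_ ?_
    · apply pet_of_branches 0 1 1 (n + 1) 2 (n + 2) 2 (-1) <;> push_cast <;> linarith
    · simp only [Set.mem_ofPred_eq]; linarith
  | @endFix x h =>
    refine .cons (q := (x - b + 2 * (n - 1) * a, h)) ?_ ?_ (.last ?_ ?_)
    · apply pet_of_branches 0 2 1 (n + 1) 1 2 1 (-1) <;> push_cast <;> linarith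
    · simp only [Set.mem_ofPred_eq, not_le]; linarith
    · apply pet_of_branches 1 (n + 1) 1 2 1 (n + 1) 1 0 <;> push_cast <;> linarith
    · simp only [Set.mem_ofPred_eq]; linarith

end TripleLattice

/-! ### First returns, irregular points and stability under perturbation -/

namespace TripleLattice

open Filter Topology

section Ret

variable {α : Type*} {f : α → α → Prop} {Y Z : Set α} {p q r : α}

theorem Ret.mem (h : Ret f Y p q) : q ∈ Y := by
  induction h with
  | last _ h => exact h
  | cons _ _ _ ih => exact ih

theorem Ret.mono_rel {g : α → α → Prop} (hfg : ∀ p q, f p q → g p q) (h : Ret f Y p q) :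
    Ret g Y p q := by
  induction h with
  | last h h' => exact .last (hfg _ _ h) h'
  | cons h h' _ ih => exact .cons (hfg _ _ h) h' ih

theorem Ret.congr (hYZ : ∀ p q, f p q → (q ∈ Y ↔ q ∈ Z)) (h : Ret f Y p q) : Ret f Z p q := by
  induction h with
  | last h h' => exact .last h ((hYZ _ _ h).1 h')
  | cons h h' _ ih => exact .cons h (mt (hYZ _ _ h).2 h') ih

theorem Ret.restrict (h : Ret f Z p q) (hYZ : Y ⊆ Z) (hq : q ∈ Y) : Ret f Y p q := by
  induction h with
  | last h _ => exact .last h hq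
  | cons h h' _ ih => exact .cons h (fun hY => h' (hYZ hY)) (ih hq)

/-- With `Ret.restrict`, this lets a first return to `Y` be assembled from successive first returns
to a larger set. -/
theorem Ret.trans (h : Ret f Z p r) (hYZ : Y ⊆ Z) (hr : r ∉ Y) (h' : Ret f Y r q) :
    Ret f Y p q := by
  induction h with
  | last h _ => exact .cons h hr h'
  | cons h h'' _ ih => exact .cons h (fun hY => h'' (hYZ hY)) (ih hr h')

theorem Ret.preserves {P : α → Prop} (hP : ∀ p q, f p q → P p → P q) (h : Ret f Y p q)
    (hp : P p) : P q := by
  induction h with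
  | last h _ => exact hP _ _ h hp
  | cons h _ _ ih => exact ih (hP _ _ h hp)

theorem Ret.unique (hf : ∀ p q q', f p q → f p q' → q = q') (h : Ret f Y p q)
    (h' : Ret f Y p r) : q = r := by
  induction h with
  | last h hY =>
    cases h' with
    | last k _ => exact hf _ _ _ h k
    | cons k kY _ => exact absurd (hf _ _ _ h k ▸ hY) kY
  | cons h hY _ ih =>
    cases h' with
    | last k kY => exact absurd (hf _ _ _ k h ▸ kY) hY
    | cons k _ hr => exact ih (hf _ _ _ h k ▸ hr)

end Ret

/-- The point avoids all lines of the three side directions through the lattice points. -/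
def Irreg (a b : ℝ) (p : ℝ × ℝ) : Prop :=
  (∀ i j : ℤ, p.1 ≠ i * a + j * b) ∧ (∀ i j : ℤ, p.2 ≠ i * a + j * b) ∧
    ∀ i j : ℤ, p.1 + p.2 ≠ i * a + j * b

theorem step_total {a b : ℝ} {p : ℝ × ℝ}
    (hp : p ∈ Set.Ioo 0 b ×ˢ Set.Ioo 0 a) (hi : Irreg a b p) : ∃ q, Step a b p q := by
  obtain ⟨x, h⟩ := p
  obtain ⟨⟨hx0, hxb⟩, hh0, hha⟩ := hp
  obtain ⟨hx, hh, hxh⟩ := hi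
  dsimp only at *
  have ne {y : ℝ} (hy : ∀ i j : ℤ, y ≠ i * a + j * b) (i j : ℤ) (c : ℝ)
      (hc : c = i * a + j * b) : y < c ∨ c < y := lt_or_gt_of_ne (hc ▸ hy i j)
  rcases ne hx 1 0 a (by simp) with h1 | h1
  · rcases ne hxh 2 (-1) (2 * a - b) (by push_cast; ring) with h2 | h2
    · exact ⟨_, .lowFix hx0 hh0 h2⟩
    rcases ne hh 2 (-1) (2 * a - b) (by push_cast; ring) with h3 | h3
    · rcases ne hx (-1) 1 (b - a) (by push_cast; ring) with h4 | h4
      · exact ⟨_, .far hx0 h4 hh0 h3 h2⟩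
      rcases ne hxh 1 0 a (by simp) with h5 | h5
      · exact ⟨_, .upLeft hh0 h3 h4 h2 h5⟩
      · exact ⟨_, .midFix h3 h1 h5⟩
    · rcases ne hxh 3 (-1) (3 * a - b) (by push_cast; ring) with h4 | h4
      · exact ⟨_, .right hx0 h1 (by convert hx 2 (-1) using 1; push_cast; ring) h3 hha h4⟩
      rcases ne hx (-1) 1 (b - a) (by push_cast; ring) with h5 | h5
      · exact ⟨_, .topFix hx0 h5 h3 hha h4⟩
      · exact ⟨_, .dropLeft h5 h1 h3 hha h4⟩
  · rcases ne hxh 0 1 b (by simp) with h2 | h2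
    · exact ⟨_, .left h1 hh0 h2⟩
    rcases ne hxh 2 0 (2 * a) (by simp) with h3 | h3
    · rcases ne hh (-1) 1 (b - a) (by push_cast; ring) with h4 | h4
      · exact ⟨_, .wrap h1 hxb h4 h2 h3⟩
      · exact ⟨_, .down h1 hxb h4 h2 h3⟩
    · exact ⟨_, .endFix hxb hha h3⟩

section Pet

variable {a b : ℝ} {n : ℤ} {p q q' : ℝ × ℝ}

theorem Pet.left_mem (h : Pet a b n p q) : p ∈ Set.Ioo 0 b ×ˢ Set.Ioo 0 a := by
  obtain ⟨u, v, w, z, h, -⟩ := h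
  exact ⟨h.2.1, h.2.2.1 ▸ h.1.2⟩

theorem Pet.right_mem (h : Pet a b n p q) : q ∈ Set.Ioo 0 b ×ˢ Set.Ioo 0 a := by
  obtain ⟨u, v, w, z, -, -, -, -, h⟩ := h
  exact ⟨h.2.1, h.2.2.1 ▸ h.1.2⟩

/-- The linear parts of the three turns cancel, so both coordinates change by elements of ℤa + ℤb.
-/
theorem Pet.irreg (h : Pet a b n p q) (hp : Irreg a b p) : Irreg a b q := by
  obtain ⟨u, v, w, z, ⟨-, -, e₀, i, e₁⟩, ⟨-, ⟨k₁, c₁⟩, m₁, d₁⟩, ⟨-, ⟨k₂, c₂⟩, m₂, d₂⟩,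
    ⟨-, ⟨k₃, c₃⟩, m₃, d₃⟩, -, -, e₂, j, e₃⟩ := h
  have h1 : q.1 = p.1 + (k₂ - k₃) * a + (m₃ - m₁ + j - i) * b := by
    linear_combination e₃ + d₃ - c₃ + c₂ - d₁ - e₁
  have h2 : q.2 = p.2 + (k₃ - k₁) * a + (m₁ - m₂) * b := by
    linear_combination e₂ + c₃ - d₂ + d₁ - c₁ - e₀
  refine ⟨fun r t e => hp.1 (r - (k₂ - k₃)) (t - (m₃ - m₁ + j - i)) ?_,
    fun r t e => hp.2.1 (r - (k₃ - k₁)) (t - (m₁ - m₂)) ?_,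
    fun r t e => hp.2.2 (r - (k₂ - k₁)) (t - (m₃ - m₂ + j - i)) ?_⟩
  all_goals push_cast
  · linear_combination e - h1
  · linear_combination e - h2
  · linear_combination e - h1 - h2

theorem eq_of_add_int_mul {y y' z c : ℝ} {k k' : ℤ} (hy : y ∈ Set.Ioo 0 c)
    (hy' : y' ∈ Set.Icc 0 c) (h : y = z + k * c) (h' : y' = z + k' * c) : y = y' := by
  have hc : 0 < c := hy.1.trans hy.2
  have h1 : ((k - k' : ℤ) : ℝ) * c < 1 * c := by
    push_cast; linarith [hy.2, hy'.1]
  have h2 : (-1 : ℝ) * c < ((k - k' : ℤ) : ℝ) * c := by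
    push_cast; linarith [hy.1, hy'.2]
  have h3 : k - k' < 1 := by exact_mod_cast lt_of_mul_lt_mul_right h1 hc.le
  have h4 : -1 < k - k' := by exact_mod_cast lt_of_mul_lt_mul_right h2 hc.le
  obtain rfl : k = k' := by omega
  rw [h, h']

theorem Turn.unique (h : Turn a b p q) (h' : Turn a b p q') : q = q' := by
  obtain ⟨⟨h1, h2⟩, ⟨k, hk⟩, m, hm⟩ := h
  obtain ⟨⟨h1', h2'⟩, ⟨k', hk'⟩, m', hm'⟩ := h'
  have e := eq_of_add_int_mul h2 (Set.Ioo_subset_Icc_self h2') hk hk'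
  exact Prod.ext (eq_of_add_int_mul h1 (Set.Ioo_subset_Icc_self h1') hm (e ▸ hm')) e

theorem Shift.unique (h : Shift a b n p q) (h' : Shift a b n p q') : q = q' := by
  obtain ⟨-, h1, h2, j, hj⟩ := h
  obtain ⟨-, h1', h2', j', hj'⟩ := h'
  exact Prod.ext (eq_of_add_int_mul h1 (Set.Ioo_subset_Icc_self h1') hj hj') (h2.trans h2'.symm)

theorem Shift.unique_left (h : Shift a b n q p) (h' : Shift a b n q' p) : q = q' := by
  obtain ⟨⟨h1, -⟩, -, h2, j, hj⟩ := h
  obtain ⟨⟨h1', -⟩, -, h2', j', hj'⟩ := h'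
  refine Prod.ext (eq_of_add_int_mul (z := p.1 - n * a) (k := -j) (k' := -j') h1
    (Set.Ioo_subset_Icc_self h1') ?_ ?_) (h2.symm.trans h2')
  · push_cast; linarith
  · push_cast; linarith

theorem Pet.unique (h : Pet a b n p q) (h' : Pet a b n p q') : q = q' := by
  obtain ⟨u, v, w, z, h0, h1, h2, h3, h4⟩ := h
  obtain ⟨u', v', w', z', h0', h1', h2', h3', h4'⟩ := h'
  obtain rfl := h0.unique_left h0'
  obtain rfl := h1.unique h1'
  obtain rfl := h2.unique h2'
  obtain rfl := h3.unique h3'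
  exact h4.unique h4'

theorem Turn.smul {c : ℝ} (hc : 0 < c) (h : Turn a b p q) :
    Turn (c * a) (c * b) (c • p) (c • q) := by
  obtain ⟨⟨h1, h2⟩, ⟨k, hk⟩, m, hm⟩ := h
  refine ⟨⟨⟨mul_pos hc h1.1, mul_lt_mul_of_pos_left h1.2 hc⟩, mul_pos hc h2.1,
    mul_lt_mul_of_pos_left h2.2 hc⟩, ⟨k, ?_⟩, m, ?_⟩ <;>
    simp only [Prod.smul_fst, Prod.smul_snd, smul_eq_mul]
  · linear_combination c * hk
  · linear_combination c * hm

theorem Shift.smul {c : ℝ} (hc : 0 < c) (h : Shift a b n p q) :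
    Shift (c * a) (c * b) n (c • p) (c • q) := by
  obtain ⟨⟨h1, h2⟩, h3, h4, j, hj⟩ := h
  refine ⟨⟨⟨mul_pos hc h1.1, mul_lt_mul_of_pos_left h1.2 hc⟩, mul_pos hc h2.1,
    mul_lt_mul_of_pos_left h2.2 hc⟩, ⟨mul_pos hc h3.1, mul_lt_mul_of_pos_left h3.2 hc⟩,
    congrArg (c * ·) h4, j, ?_⟩
  simp only [Prod.smul_fst, smul_eq_mul]
  linear_combination c * hj

theorem Pet.smul {c : ℝ} (hc : 0 < c) (h : Pet a b n p q) :
    Pet (c * a) (c * b) n (c • p) (c • q) := by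
  obtain ⟨u, v, w, z, h0, h1, h2, h3, h4⟩ := h
  exact ⟨_, _, _, _, h0.smul hc, h1.smul hc, h2.smul hc, h3.smul hc, h4.smul hc⟩

/-- The linear part of `Turn`. -/
def rot (v : ℝ × ℝ) : ℝ × ℝ := (v.2, -(v.1 + v.2))

theorem tendsto_rot : Tendsto rot (𝓝 0) (𝓝 0) := by
  have h : Continuous rot := by unfold rot; fun_prop
  have h0 : rot 0 = 0 := by ext <;> simp [rot]
  simpa only [h0] using h.tendsto 0

theorem rot_rot_rot (v : ℝ × ℝ) : rot (rot (rot v)) = v := by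
  ext <;> simp [rot]

theorem eventually_add_mem_Ioo {x c d : ℝ} {g : ℝ × ℝ → ℝ} (hg : Continuous g) (h0 : g 0 = 0)
    (hx : x ∈ Set.Ioo c d) : ∀ᶠ v in 𝓝 (0 : ℝ × ℝ), x + g v ∈ Set.Ioo c d := by
  have h : Continuous fun v => x + g v := by fun_prop
  exact h.continuousAt.eventually (isOpen_Ioo.mem_nhds (by simpa [h0] using hx))

theorem Turn.eventually (h : Turn a b p q) : ∀ᶠ v in 𝓝 0, Turn a b (p + v) (q + rot v) := by
  obtain ⟨⟨h1, h2⟩, ⟨k, hk⟩, m, hm⟩ := h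
  filter_upwards [eventually_add_mem_Ioo (g := fun v => v.2) (by fun_prop) rfl h1,
    eventually_add_mem_Ioo (g := fun v => -(v.1 + v.2)) (by fun_prop) (by simp) h2]
    with v hv1 hv2
  refine ⟨⟨hv1, hv2⟩, ⟨k, ?_⟩, m, ?_⟩ <;> simp only [Prod.fst_add, Prod.snd_add, rot]
  · linear_combination hk
  · linear_combination hm

theorem Shift.eventually (h : Shift a b n p q) : ∀ᶠ v in 𝓝 0, Shift a b n (p + v) (q + v) := by
  obtain ⟨⟨h1, h2⟩, h3, h4, j, hj⟩ := h
  filter_upwards [eventually_add_mem_Ioo (g := fun v => v.1) (by fun_prop) rfl h1,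
    eventually_add_mem_Ioo (g := fun v => v.2) (by fun_prop) rfl h2,
    eventually_add_mem_Ioo (g := fun v => v.1) (by fun_prop) rfl h3] with v hv1 hv2 hv3
  refine ⟨⟨hv1, hv2⟩, hv3, congrArg (· + v.2) h4, j, ?_⟩
  simp only [Prod.fst_add]
  linear_combination hj

theorem Pet.eventually (h : Pet a b n p q) : ∀ᶠ v in 𝓝 0, Pet a b n (p + v) (q + v) := by
  obtain ⟨u, v, w, z, h0, h1, h2, h3, h4⟩ := h
  filter_upwards [h0.eventually, h1.eventually, tendsto_rot.eventually h2.eventually,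
    (tendsto_rot.comp tendsto_rot).eventually h3.eventually, h4.eventually]
    with t k0 k1 k2 k3 k4
  refine ⟨_, _, _, _, k0, k1, k2, ?_, k4⟩
  simpa only [Function.comp, rot_rot_rot] using k3

end Pet

/-- Since `Y` is closed, intermediate points stay outside it when moved slightly. The endpoint may
lie on the boundary of `Y`, hence the condition on `q + v`. -/
theorem Ret.eventually {f : ℝ × ℝ → ℝ × ℝ → Prop} {Y : Set (ℝ × ℝ)} {p q : ℝ × ℝ}
    (hf : ∀ p q, f p q → ∀ᶠ v in 𝓝 0, f (p + v) (q + v)) (hY : IsClosed Y)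
    (h : Ret f Y p q) : ∀ᶠ v in 𝓝 0, q + v ∈ Y → Ret f Y (p + v) (q + v) := by
  induction h with
  | last h _ => exact (hf _ _ h).mono fun v hv => .last hv
  | @cons p r q h hr _ ih =>
    have hc : Continuous fun v => r + v := by fun_prop
    have : ∀ᶠ v in 𝓝 0, r + v ∉ Y :=
      hc.continuousAt.eventually (hY.isOpen_compl.mem_nhds (by simpa using hr))
    filter_upwards [hf _ _ h, ih, this] with v h1 h2 h3 hq
    exact .cons h1 h3 (h2 hq)

end TripleLattice

/-! ### Induction over the gluings -/

namespace TripleLattice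

section Flip

variable {a b c : ℝ} {p q p' q' : ℝ × ℝ}

theorem Step.irreg (hab : a ≤ b) (hba : b ≤ 2 * a) (h : Step a b p q) (hp : Irreg a b p) :
    Irreg a b q :=
  (h.pet hab hba).irreg hp

theorem ret_of_ret_glue {Y Y' : Set (ℝ × ℝ)} (hab : a < b) (h32 : 2 * b ≤ 3 * a)
    (hY : Y ⊆ kept a b) (hYY : ∀ r r', Glue a b r r' → (r' ∈ Y' ↔ r ∈ Y))
    (h : Ret (Step (2 * a - b) a) Y' p' q') (hp : Irreg a b p) (hg : Glue a b p p') :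
    ∃ q, Glue a b q q' ∧ Ret (Step a b) Y p q := by
  have hne {r : ℝ × ℝ} (hr : Irreg a b r) : r.1 + (b - a) ≠ 2 * a - b := fun e =>
    hr.1 3 (-2) (by push_cast; linarith)
  induction h generalizing p with
  | last h hq =>
    obtain ⟨q, hq', hr⟩ := ret_of_step_glue hab h32 (hne hp) hg h
    exact ⟨q, hq', hr.restrict hY ((hYY _ _ hq').1 hq)⟩
  | cons h hq _ ih =>
    obtain ⟨r, hr', hr⟩ := ret_of_step_glue hab h32 (hne hp) hg h
    have hi := hr.preserves (fun _ _ h hp => h.irreg hab.le (by linarith) hp) hp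
    obtain ⟨q, hq', hret⟩ := ih hi hr'
    exact ⟨q, hq', hr.trans hY (mt (hYY _ _ hr').2 hq) hret⟩

/-- The first return to the upper left part of width `b - a` and height `c`, turned over. -/
def FlipRet (a b c : ℝ) : Prop :=
  ∀ p ∈ Set.Ioo 0 b ×ˢ Set.Ioo 0 a, Irreg a b p → p.1 < b - a → a - c < p.2 →
    ∃ q, Step (b - a) c (a - p.2, b - a - p.1) (a - q.2, b - a - q.1) ∧
      Ret (Step a b) {p | p.1 ≤ b - a ∧ a - c ≤ p.2} p q

theorem flipRet_self (hab : a < b) (hba : b ≤ 2 * a) (h32 : 3 * a < 2 * b) : FlipRet a b a := by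
  rintro ⟨x, h⟩ ⟨⟨hx0, hxb⟩, hh0, hha⟩ ⟨hx, hh, hxh⟩ hlt -
  dsimp only at *
  obtain ⟨q', hq'⟩ := step_total (a := b - a) (b := a) (p := (a - h, b - a - x))
    ⟨⟨by linarith, by linarith⟩, by dsimp only; linarith, by dsimp only; linarith⟩
    ⟨fun i j e => hh (1 + i - j) (-i) (by push_cast; linarith),
      fun i j e => hx (i - j - 1) (1 - i) (by push_cast; linarith),
      fun i j e => hxh (i - j) (1 - i) (by push_cast; linarith)⟩
  obtain ⟨q, rfl, hr⟩ := ret_of_step_flip hba h32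
    (fun e => hx 2 (-1) (by push_cast; linarith)) (fun e => hx 3 (-2) (by push_cast; linarith)) hq'
  refine ⟨q, hq', hr.congr fun p q hpq => ?_⟩
  have := (hpq.pet hab.le hba).right_mem.2.1.le
  simp [this]

/-- The return set lies in the left component of the kept part, and its turned-over coordinates `a -
p.2` and `b - a - p.1` do not change under gluing. -/
theorem FlipRet.glue (hab : a < b) (h32 : 2 * b ≤ 3 * a) (hca : c ≤ 2 * a - b)
    (hF : FlipRet (2 * a - b) a c) : FlipRet a b c := by
  rintro ⟨x, h⟩ ⟨⟨hx0, hxb⟩, hh0, hha⟩ hi hlt hlt'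
  have ⟨hx, hh, hxh⟩ := hi
  dsimp only at *
  obtain ⟨q', hs, hr⟩ := hF (x, h - (b - a))
    ⟨⟨by linarith, by dsimp only; linarith⟩, by dsimp only; linarith, by dsimp only; linarith⟩
    ⟨fun i j e => hx (2 * i + j) (-i) (by push_cast; linarith),
      fun i j e => hh (2 * i + j - 1) (1 - i) (by push_cast; linarith),
      fun i j e => hxh (2 * i + j - 1) (1 - i) (by push_cast; linarith)⟩
    (by dsimp only; linarith) (by dsimp only; linarith)
  have hYY (r r' : ℝ × ℝ) (hg : Glue a b r r') :
      r' ∈ {p : ℝ × ℝ | p.1 ≤ a - (2 * a - b) ∧ 2 * a - b - c ≤ p.2} ↔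
        r ∈ {p : ℝ × ℝ | p.1 ≤ b - a ∧ a - c ≤ p.2} := by
    rcases hg with ⟨hg, rfl⟩ | ⟨hg, rfl⟩ <;> simp only [Set.mem_ofPred_eq] <;>
      constructor <;> rintro ⟨h1, h2⟩ <;> constructor <;> linarith
  obtain ⟨q, hg, hq⟩ := ret_of_ret_glue hab h32
    (fun p hp => ⟨.inl (by linarith [hp.1]), by linarith [hp.2]⟩) hYY hr hi
    (.inl ⟨by dsimp only; linarith, rfl⟩)
  refine ⟨q, ?_, hq⟩
  have hm := hq.mem
  rcases hg with ⟨-, rfl⟩ | ⟨hg, -⟩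
  · convert hs using 1
    · ring
    · exact Prod.ext (by ring) (by ring)
    · exact Prod.ext (by ring) (by ring)
  · linarith [hm.1]

/-- Each gluing lowers both sides by `b - a` and keeps their difference. After `j` of them the
shorter side is below twice the difference, and `flipRet_self` applies. -/
theorem flipRet_sub_mul (j : ℕ) (hab : a < b) (h1 : b - a ≤ a - j * (b - a))
    (h2 : a - j * (b - a) < 2 * (b - a)) : FlipRet a b (a - j * (b - a)) := by
  induction j generalizing a b with
  | zero =>
    simp only [Nat.cast_zero, zero_mul, sub_zero] at *
    exact flipRet_self hab (by linarith) (by linarith)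
  | succ j ih =>
    push_cast at *
    have e : a - (j + 1) * (b - a) = 2 * a - b - j * (a - (2 * a - b)) := by ring
    have hj : 0 ≤ j * (b - a) := mul_nonneg j.cast_nonneg (by linarith)
    rw [e]
    exact (ih (a := 2 * a - b) (b := a) (by linarith) (by linarith) (by linarith)).glue hab
      (by linarith) (by linarith)

end Flip

end TripleLattice

/-! ### From the plane to coordinates; null sets -/

namespace TripleLattice

open MeasureTheory Set

/-- The linear coordinates with respect to the sides of `X s`. -/
noncomputable def lin : (ℝ × ℝ) ≃L[ℝ] Plane :=
  LinearEquiv.toContinuousLinearEquiv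
    { toFun := fun v => !₂[2 * v.1 + v.2, Real.sqrt 3 * v.2]
      map_add' := fun v w => by
        ext i; fin_cases i <;> (simp; ring)
      map_smul' := fun c v => by
        ext i; fin_cases i <;> (simp; ring)
      invFun := fun P => ((P 0 - P 1 / Real.sqrt 3) / 2, P 1 / Real.sqrt 3)
      left_inv := fun v => by
        ext <;> simp
      right_inv := fun P => by
        ext i; fin_cases i <;> simp <;> field_simp <;> ring }

theorem lin_apply (v : ℝ × ℝ) : lin v = !₂[2 * v.1 + v.2, Real.sqrt 3 * v.2] := rfl

theorem norm_lin_sq (v : ℝ × ℝ) : ‖lin v‖ ^ 2 = 4 * (v.1 ^ 2 + v.1 * v.2 + v.2 ^ 2) := by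
  rw [EuclideanSpace.norm_sq_eq, lin_apply]
  simp only [Fin.sum_univ_two, Real.norm_eq_abs, sq_abs]
  simp [mul_pow]
  ring

/-- The parametrization of the plane that takes `[0, 1] × [0, s]` to `X s`. -/
noncomputable def emb (s : ℝ) : (ℝ × ℝ) ≃ₜ Plane :=
  lin.toHomeomorph.trans (Homeomorph.addLeft (corner s))

theorem emb_apply (s : ℝ) (v : ℝ × ℝ) : emb s v = corner s + lin v := rfl

/-- The parametrization of the plane that takes `[0, 1] × [0, s]` to `F s i`. -/
noncomputable def pt (s : ℝ) (i : Fin 3) (v : ℝ × ℝ) : Plane :=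
  corner s + v.1 • long i + v.2 • (long i + long (i + 1))

theorem pt_zero (s : ℝ) (v : ℝ × ℝ) : pt s 0 v = emb s v := by
  rw [pt, emb_apply, lin_apply, add_assoc]
  congr 1
  ext i; fin_cases i <;> simp [long] <;> ring

theorem long_add_two (i : Fin 3) : long (i + 1 + 1) = -(long i + long (i + 1)) := by
  ext j; fin_cases i <;> fin_cases j <;> simp [long] <;> norm_num

theorem short_eq (s : ℝ) (i : Fin 3) : short s i = s • (long i + long (i + 1)) := by
  ext j; fin_cases i <;> fin_cases j <;> simp [long, short] <;> ring

theorem long_indep (i : Fin 3) {α β : ℝ} (h : α • long i + β • long (i + 1) = 0) :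
    α = 0 ∧ β = 0 := by
  have h3 : Real.sqrt 3 ≠ 0 := by positivity
  have h0 := congrArg (fun P : Plane => P 0) h
  have h1 := congrArg (fun P : Plane => P 1) h
  fin_cases i <;> simp [long] at h0 h1
  · exact ⟨by linarith, h1⟩
  · have h2 : Real.sqrt 3 * (α - β) = 0 := by linarith
    have := (mul_eq_zero.1 h2).resolve_left h3
    constructor <;> linarith
  · exact ⟨h1, by linarith⟩

theorem pt_succ (s : ℝ) (i : Fin 3) (v : ℝ × ℝ) :
    pt s (i + 1) v = corner s + v.1 • long (i + 1) - v.2 • long i := by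
  rw [pt, long_add_two]
  module

theorem pt_injective (s : ℝ) (i : Fin 3) : Function.Injective (pt s i) := by
  intro v w h
  have h1 := long_indep i (α := v.1 - w.1 + (v.2 - w.2)) (β := v.2 - w.2) (by
    rw [← sub_self (pt s i w)]
    nth_rw 1 [← h]
    rw [pt, pt]
    module)
  exact Prod.ext (by linarith) (by linarith)

theorem F_eq {s : ℝ} (hs : 0 < s) (i : Fin 3) : F s i = pt s i '' (Icc 0 1 ×ˢ Icc 0 s) := by
  ext P
  constructor
  · rintro ⟨α, hα, β, hβ, rfl⟩
    refine ⟨(α, β * s), ⟨hα, mul_nonneg hβ.1 hs.le, mul_le_of_le_one_left hs.le hβ.2⟩, ?_⟩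
    rw [pt, short_eq]
    module
  · rintro ⟨v, ⟨h1, h2⟩, rfl⟩
    refine ⟨v.1, h1, v.2 / s, ⟨div_nonneg h2.1 hs.le, (div_le_one hs).2 h2.2⟩, ?_⟩
    rw [pt, short_eq, smul_smul, div_mul_cancel₀ _ hs.ne']

theorem pt_mem_F {s : ℝ} (hs : 0 < s) {i : Fin 3} {v : ℝ × ℝ} :
    pt s i v ∈ F s i ↔ v ∈ Icc (0 : ℝ) 1 ×ˢ Icc 0 s := by
  rw [F_eq hs, (pt_injective s i).mem_set_image]

theorem sub_mem_L {s : ℝ} {i : Fin 3} {v w : ℝ × ℝ} :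
    pt s (i + 1) w - pt s i v ∈ L s i ↔
      (∃ k : ℤ, w.2 = -(v.1 + v.2) + k * s) ∧ ∃ m : ℤ, w.1 = -v.1 - w.2 + m * 1 := by
  rw [L, AddSubgroup.mem_closure_pair]
  constructor
  · rintro ⟨k, m, h⟩
    have h1 := long_indep i (α := k * s + w.2 + v.1 + v.2) (β := k * s + m - w.1 + v.2) (by
      rw [← sub_self (pt s (i + 1) w - pt s i v)]
      nth_rw 1 [← h]
      rw [pt_succ, pt, short_eq, ← Int.cast_smul_eq_zsmul ℝ, ← Int.cast_smul_eq_zsmul ℝ]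
      module)
    refine ⟨⟨-k, ?_⟩, m, ?_⟩
    · push_cast; linarith
    · linarith
  · rintro ⟨⟨k, hk⟩, m, hm⟩
    refine ⟨-k, m, ?_⟩
    rw [pt_succ, pt, short_eq, ← Int.cast_smul_eq_zsmul ℝ, ← Int.cast_smul_eq_zsmul ℝ, hm, hk]
    push_cast
    module

/-- The lattice vector is unique exactly when the image is interior: a boundary point has a
translate on the opposite side. -/
theorem latticeStep_iff {s : ℝ} (hs : 0 < s) {i : Fin 3} {v w : ℝ × ℝ} :
    LatticeStep s i (pt s i v) (pt s (i + 1) w) ↔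
      v ∈ Icc (0 : ℝ) 1 ×ˢ Icc 0 s ∧ Turn s 1 v w := by
  rw [LatticeStep, pt_mem_F hs, pt_mem_F hs, sub_mem_L]
  constructor
  · rintro ⟨hv, hV, ⟨⟨k, hk⟩, m, hm⟩, hw⟩
    have uniq {w' : ℝ × ℝ} (hw' : w' ∈ Icc (0 : ℝ) 1 ×ˢ Icc 0 s) (k' m' : ℤ)
        (hk' : w'.2 = w.2 + k' * s) (hm' : w'.1 = w.1 + w.2 - w'.2 + m') : w' = w := by
      refine pt_injective s (i + 1) (sub_left_injective (b := pt s i v) (hV.unique ⟨?_, ?_⟩ ⟨?_, ?_⟩))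
      · exact sub_mem_L.2 ⟨⟨k + k', by push_cast; linarith⟩, m + m', by push_cast; linarith⟩
      · simpa [pt_mem_F hs] using hw'
      · exact sub_mem_L.2 ⟨⟨k, hk⟩, m, hm⟩
      · simpa [pt_mem_F hs] using hw
    have fr (y : ℝ) : Int.fract y ∈ Icc (0 : ℝ) 1 := ⟨Int.fract_nonneg y, (Int.fract_lt_one y).le⟩
    refine ⟨hv, ⟨⟨hw.1.1.lt_of_ne' fun h => ?_, hw.1.2.lt_of_ne fun h => ?_⟩,
      hw.2.1.lt_of_ne' fun h => ?_, hw.2.2.lt_of_ne fun h => ?_⟩, ⟨k, hk⟩, m, hm⟩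
    · have := congrArg Prod.fst (uniq (w' := (1, w.2)) ⟨by simp, hw.2⟩ 0 1 (by simp) (by simp [h]))
      simp [h] at this
    · have := congrArg Prod.fst
        (uniq (w' := (0, w.2)) ⟨by simp, hw.2⟩ 0 (-1) (by simp) (by simp [h]))
      simp [h] at this
    -- Raising the second coordinate from 0 to `s` moves the first by `-s`, which is then reduced
    -- modulo 1.
    · have := congrArg Prod.snd (uniq (w' := (Int.fract (w.1 - s), s)) ⟨fr _, by simp [hs.le]⟩ 1
        (-⌊w.1 - s⌋) (by simp [h]) (by rw [Int.fract]; push_cast; linarith))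
      simp [h, hs.ne'] at this
    · have := congrArg Prod.snd (uniq (w' := (Int.fract (w.1 + s), 0)) ⟨fr _, by simp [hs.le]⟩ (-1)
        (-⌊w.1 + s⌋) (by simp [h]) (by rw [Int.fract]; push_cast; linarith))
      simp [h, hs.ne] at this
  · rintro ⟨hv, ⟨h1, h2⟩, hL⟩
    refine ⟨hv, ⟨pt s (i + 1) w - pt s i v, ⟨sub_mem_L.2 hL, ?_⟩, ?_⟩, hL,
      ⟨Ioo_subset_Icc_self h1, Ioo_subset_Icc_self h2⟩⟩
    · rw [add_sub_cancel, pt_mem_F hs]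
      exact ⟨Ioo_subset_Icc_self h1, Ioo_subset_Icc_self h2⟩
    · rintro V ⟨hV, hVF⟩
      obtain ⟨w', hw', e⟩ := F_eq hs (i + 1) ▸ hVF
      obtain rfl : V = pt s (i + 1) w' - pt s i v := by rw [e, add_sub_cancel_left]
      obtain ⟨⟨k, hk⟩, m, hm⟩ := hL
      obtain ⟨⟨k', hk'⟩, m', hm'⟩ := sub_mem_L.1 hV
      have e2 := eq_of_add_int_mul h2 hw'.2 hk hk'
      rw [← e2] at hm'
      rw [Prod.ext (eq_of_add_int_mul h1 hw'.1 hm hm') e2]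

theorem cubeStep_iff {s : ℝ} (hs : 0 < s) {u z : ℝ × ℝ} :
    CubeStep s (emb s u) (emb s z) ↔ u ∈ Icc (0 : ℝ) 1 ×ˢ Icc 0 s ∧
      ∃ v w, Turn s 1 u v ∧ Turn s 1 v w ∧ Turn s 1 w z := by
  have mem {p q : ℝ × ℝ} (h : Turn s 1 p q) : q ∈ Icc (0 : ℝ) 1 ×ˢ Icc 0 s :=
    ⟨Ioo_subset_Icc_self h.1.1, Ioo_subset_Icc_self h.1.2⟩
  simp only [CubeStep, ← pt_zero]
  constructor
  · rintro ⟨A, B, h1, h2, h3⟩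
    obtain ⟨v, -, rfl⟩ := F_eq hs 1 ▸ h2.1
    obtain ⟨w, -, rfl⟩ := F_eq hs 2 ▸ h3.1
    have k1 := (latticeStep_iff hs (i := 0)).1 h1
    exact ⟨k1.1, v, w, k1.2, ((latticeStep_iff hs (i := 1)).1 h2).2,
      ((latticeStep_iff hs (i := 2)).1 h3).2⟩
  · rintro ⟨hu, v, w, h1, h2, h3⟩
    exact ⟨pt s 1 v, pt s 2 w, (latticeStep_iff hs (i := 0)).2 ⟨hu, h1⟩,
      (latticeStep_iff hs (i := 1)).2 ⟨mem h1, h2⟩, (latticeStep_iff hs (i := 2)).2 ⟨mem h2, h3⟩⟩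

theorem X_eq {s : ℝ} (hs : 0 < s) : X s = emb s '' (Icc 0 1 ×ˢ Icc 0 s) := by
  rw [X, F_eq hs]
  exact image_congr fun v _ => pt_zero s v

theorem parallelogram_eq {s w : ℝ} (hs : 0 < s) (hw : 0 ≤ w) :
    parallelogram (corner s) !₂[2 * w, 0] (short s 0) = emb s '' (Icc 0 w ×ˢ Icc 0 s) := by
  have key (x h : ℝ) : emb s (x, h) = corner s + !₂[2 * x, 0] + !₂[h, Real.sqrt 3 * h] := by
    rw [emb_apply, lin_apply, add_assoc]
    congr 1
    ext i; fin_cases i <;> simp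
  have smul1 (c x : ℝ) : c • (!₂[2 * x, 0] : Plane) = !₂[2 * (c * x), 0] := by
    ext i; fin_cases i <;> simp; ring
  have smul2 (c : ℝ) : c • short s 0 = !₂[c * s, Real.sqrt 3 * (c * s)] := by
    ext i; fin_cases i <;> simp [short]; ring
  ext P
  constructor
  · rintro ⟨α, hα, β, hβ, rfl⟩
    refine ⟨(α * w, β * s), ⟨⟨mul_nonneg hα.1 hw, mul_le_of_le_one_left hw hα.2⟩,
      mul_nonneg hβ.1 hs.le, mul_le_of_le_one_left hs.le hβ.2⟩, ?_⟩
    rw [key, smul1, smul2]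
  · rintro ⟨⟨x, h⟩, ⟨h1, h2⟩, rfl⟩
    refine ⟨x / w, ⟨div_nonneg h1.1 hw, div_le_one_of_le₀ h1.2 hw⟩,
      h / s, ⟨div_nonneg h2.1 hs.le, (div_le_one hs).2 h2.2⟩, ?_⟩
    -- If `w = 0` the parallelogram is a segment, and `x = 0`.
    have : x / w * w = x := by
      rcases hw.eq_or_lt with rfl | hw
      · rw [mul_zero]; exact le_antisymm h1.1 h1.2
      · exact div_mul_cancel₀ _ hw.ne'
    rw [key, smul1, smul2, this, div_mul_cancel₀ _ hs.ne']

theorem emb_add (s x : ℝ) (v : ℝ × ℝ) : emb s v + !₂[2 * x, 0] = emb s (v + (x, 0)) := by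
  have : lin (x, 0) = !₂[2 * x, 0] := by rw [lin_apply]; simp
  rw [emb_apply, emb_apply, map_add, this, add_assoc]

theorem cutPaste_iff {s : ℝ} (hs : 0 < s) {u p : ℝ × ℝ} :
    CutPaste s (emb s u) (emb s p) ↔ Shift s 1 ⌊1 / s⌋ u p := by
  obtain ⟨w, hw⟩ : ∃ w, w = 1 - ⌊1 / s⌋ * s := ⟨_, rfl⟩
  have hw0 : 0 ≤ w := by
    have := mul_le_mul_of_nonneg_right (Int.floor_le (1 / s)) hs.le
    rw [div_mul_cancel₀ _ hs.ne'] at this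
    linarith
  have hw1 : w ≤ 1 := by
    have : (0 : ℝ) ≤ ⌊1 / s⌋ := by exact_mod_cast Int.floor_nonneg.2 (by positivity)
    nlinarith
  have hc : cutWidth s = 2 * w := by rw [cutWidth, hw]; ring
  have hX : X s \ cutPart s = emb s '' (Ioc w 1 ×ˢ Icc 0 s) := by
    rw [cutPart, hc, parallelogram_eq hs hw0, X_eq hs, ← image_sdiff (emb s).injective]
    congr 1
    ext ⟨x, h⟩
    simp only [mem_sdiff, mem_prod, mem_Icc, mem_Ioc]
    grind
  have h1 : emb s u + !₂[2 - 2 * w, 0] = emb s (u + (1 - w, 0)) := by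
    rw [← emb_add]; congr; ring
  have h2 : emb s u - !₂[2 * w, 0] = emb s (u + (-w, 0)) := by
    rw [← emb_add, sub_eq_add_neg]; congr 1; ext i; fin_cases i <;> simp
  rw [CutPaste, hX, cutPart, hc, parallelogram_eq hs hw0, ← (emb s).image_interior,
    ← (emb s).image_interior, (emb s).injective.mem_set_image, (emb s).injective.mem_set_image,
    h1, h2, (emb s).injective.eq_iff, (emb s).injective.eq_iff, interior_prod_eq, interior_prod_eq,
    interior_Icc, interior_Icc, interior_Ioc, Shift]
  obtain ⟨x, h⟩ := u
  obtain ⟨y, k⟩ := p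
  simp only [Prod.mk_add_mk, Prod.mk.injEq, mem_prod, mem_Ioo, add_zero]
  constructor
  · rintro (⟨⟨hx, hh⟩, rfl, rfl⟩ | ⟨⟨hx, hh⟩, rfl, rfl⟩)
    · exact ⟨⟨⟨hx.1, by linarith⟩, hh⟩, ⟨by linarith, by linarith⟩, rfl, 0, by push_cast; linarith⟩
    · exact ⟨⟨⟨by linarith, hx.2⟩, hh⟩, ⟨by linarith, by linarith⟩, rfl, -1, by
        push_cast; linarith⟩
  · rintro ⟨⟨hx, hh⟩, hy, rfl, j, hj⟩
    have hj1 : (j : ℝ) < 1 := by linarith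
    have hj2 : (-2 : ℝ) < j := by linarith
    have hj1' : j < 1 := by exact_mod_cast hj1
    have hj2' : -2 < j := by exact_mod_cast hj2
    obtain rfl | rfl : j = 0 ∨ j = -1 := by omega
    · push_cast at hj
      exact .inl ⟨⟨⟨hx.1, by linarith⟩, hh⟩, by linarith, rfl⟩
    · push_cast at hj
      exact .inr ⟨⟨⟨by linarith, hx.2⟩, hh⟩, by linarith, rfl⟩

theorem petStep_iff {s : ℝ} (hs : 0 < s) {p q : ℝ × ℝ} :
    PETStep s (emb s p) (emb s q) ↔ Pet s 1 ⌊1 / s⌋ p q := by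
  constructor
  · rintro ⟨P, Q, h1, h2, h3⟩
    obtain ⟨u, rfl⟩ := (emb s).surjective P
    obtain ⟨z, rfl⟩ := (emb s).surjective Q
    obtain ⟨-, v, w, hT⟩ := (cubeStep_iff hs).1 h2
    exact ⟨u, v, w, z, (cutPaste_iff hs).1 h1, hT.1, hT.2.1, hT.2.2, (cutPaste_iff hs).1 h3⟩
  · rintro ⟨u, v, w, z, h0, h1, h2, h3, h4⟩
    exact ⟨emb s u, emb s z, (cutPaste_iff hs).2 h0, (cubeStep_iff hs).2
      ⟨⟨Ioo_subset_Icc_self h0.1.1, Ioo_subset_Icc_self h0.1.2⟩, v, w, h1, h2, h3⟩,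
      (cutPaste_iff hs).2 h4⟩

theorem firstReturn_iff {s : ℝ} (hs : 0 < s) {Y : Set (ℝ × ℝ)} {p q : ℝ × ℝ} :
    FirstReturn (PETStep s) (emb s '' Y) (emb s p) (emb s q) ↔
      p ∈ Y ∧ Ret (Pet s 1 ⌊1 / s⌋) Y p q := by
  rw [FirstReturn, (emb s).injective.mem_set_image, (emb s).injective.mem_set_image]
  refine and_congr_right fun hp => ⟨?_, fun h => ⟨h.mem, ?_⟩⟩ <;> clear hp
  · rintro ⟨hq, n, o, hn, h0, h1, h2, h3⟩
    induction n generalizing o p with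
    | zero => exact absurd hn (lt_irrefl 0)
    | succ n ih =>
      obtain ⟨r, hr⟩ := (emb s).surjective (o 1)
      have hpr : Pet s 1 ⌊1 / s⌋ p r := by
        rw [← petStep_iff hs, hr, ← h0]
        exact h2 0 hn
      rcases n.eq_zero_or_pos with rfl | hn
      · obtain rfl : r = q := (emb s).injective (hr.trans h1)
        exact .last hpr hq
      · refine .cons hpr ?_ (ih (o := fun k => o (k + 1)) hn hr.symm h1
          (fun k hk => h2 (k + 1) (by omega)) fun k hk hk' => h3 (k + 1) (by omega) (by omega))
        rw [← (emb s).injective.mem_set_image, hr]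
        exact h3 1 one_pos (by omega)
  · induction h with
    | @last p q h hq =>
      refine ⟨1, fun k => if k = 0 then emb s p else emb s q, one_pos, rfl, rfl, ?_, ?_⟩
      · intro k hk
        obtain rfl : k = 0 := by omega
        simpa using (petStep_iff hs).2 h
      · intro k h1 h2
        omega
    | @cons p r q h hr _ ih =>
      obtain ⟨n, o, hn, h0, h1, h2, h3⟩ := ih
      refine ⟨n + 1, fun k => if k = 0 then emb s p else o (k - 1), by omega, rfl, by simpa,
        fun k hk => ?_, fun k hk hk' => ?_⟩
      · rcases k.eq_zero_or_pos with rfl | hk0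
        · simpa [h0] using (petStep_iff hs).2 h
        · obtain ⟨k, rfl⟩ := Nat.exists_eq_add_of_le' hk0
          simpa using h2 k (by omega)
      · obtain ⟨k, rfl⟩ := Nat.exists_eq_add_of_le' hk
        rcases k.eq_zero_or_pos with rfl | hk0
        · simpa [h0, (emb s).injective.mem_set_image] using hr
        · simpa using h3 k hk0 (by omega)

theorem volume_linear_eq {f : Plane →ₗ[ℝ] ℝ} (hf : f ≠ 0) (c : ℝ) :
    volume {P | f P = c} = 0 := by
  have h := Measure.addHaar_affineSubspace (volume : Measure Plane)
    ((AffineSubspace.mk' c ⊥).comap f.toAffineMap) ?_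
  · convert h using 2
    ext P
    simp [AffineSubspace.mem_mk', sub_eq_zero]
  · intro h
    obtain ⟨v, hv⟩ : ∃ v, f v ≠ 0 := by
      by_contra! hv
      exact hf (LinearMap.ext hv)
    have : ((c + 1) / f v) • v ∈ (AffineSubspace.mk' c ⊥).comap f.toAffineMap := h ▸ trivial
    simp [AffineSubspace.mem_mk', hv] at this

theorem ae_irreg (s : ℝ) : ∀ᵐ P : Plane, Irreg s 1 ((emb s).symm P) := by
  have key (g : (ℝ × ℝ) →ₗ[ℝ] ℝ) (hg : g ≠ 0) :
      ∀ᵐ P : Plane, ∀ i j : ℤ, g ((emb s).symm P) ≠ i * s + j * 1 := by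
    rw [ae_all_iff]
    intro i
    rw [ae_all_iff]
    intro j
    let f : Plane →ₗ[ℝ] ℝ := g ∘ₗ lin.symm.toLinearEquiv.toLinearMap
    have hf : f ≠ 0 := fun h => hg (LinearMap.ext fun v => by
      simpa [f] using LinearMap.congr_fun h (lin v))
    refine measure_mono_null ?_ (volume_linear_eq hf (i * s + j * 1 + f (corner s)))
    intro P hP
    simp only [ne_eq, mem_compl_iff, mem_ofPred_eq, not_not] at hP
    rw [mem_ofPred_eq, ← hP]
    obtain ⟨v, rfl⟩ := (emb s).surjective P
    rw [Homeomorph.symm_apply_apply, emb_apply, map_add, add_comm]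
    simp [f]
  have h1 := key (LinearMap.fst ℝ ℝ ℝ) fun h => by
    simpa using LinearMap.congr_fun h (1, 0)
  have h2 := key (LinearMap.snd ℝ ℝ ℝ) fun h => by
    simpa using LinearMap.congr_fun h (0, 1)
  have h3 := key (LinearMap.fst ℝ ℝ ℝ + LinearMap.snd ℝ ℝ ℝ) fun h => by
    simpa using LinearMap.congr_fun h (1, 0)
  filter_upwards [h1, h2, h3] with P k1 k2 k3
  exact ⟨k1, k2, k3⟩

end TripleLattice

/-! ### From generic points to the full statement -/

namespace TripleLattice

open MeasureTheory Set Filter Topology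

theorem dense_irreg (s : ℝ) : Dense {p | Irreg s 1 p} := by
  have h : Dense {P : Plane | Irreg s 1 ((emb s).symm P)} := Measure.dense_of_ae (ae_irreg s)
  have h' := h.preimage (emb s).isOpenMap
  simpa using h'

section Transfer

variable {s t x₀ x₁ y₀ y₁ : ℝ} {A : ℝ × ℝ → ℝ × ℝ}

/-- Both sides are translations near `p`, up to `A`, so a disagreement at `p` would persist at a
nearby irregular point, where `hcore` and uniqueness of first returns exclude it. -/
theorem ret_agree {n m : ℤ} (hx : x₀ < x₁) (hy : y₀ < y₁) (hAc : Continuous A)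
    (hY : ∀ p, p ∈ Icc x₀ x₁ ×ˢ Icc y₀ y₁ ↔ A p ∈ Icc (0 : ℝ) 1 ×ˢ Icc 0 t)
    (hcore : ∀ p ∈ Ioo x₀ x₁ ×ˢ Ioo y₀ y₁, Irreg s 1 p →
      ∃ q, Pet t 1 m (A p) (A q) ∧ Ret (Pet s 1 n) (Icc x₀ x₁ ×ˢ Icc y₀ y₁) p q)
    {p q q' : ℝ × ℝ} (h : Ret (Pet s 1 n) (Icc x₀ x₁ ×ˢ Icc y₀ y₁) p q)
    (h' : Pet t 1 m (A p) q') : A q = q' := by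
  by_contra hne
  have hint : interior (Icc x₀ x₁ ×ˢ Icc y₀ y₁) = Ioo x₀ x₁ ×ˢ Ioo y₀ y₁ := by
    rw [interior_prod_eq, interior_Icc, interior_Icc]
  have hcl : closure (Ioo x₀ x₁ ×ˢ Ioo y₀ y₁) = Icc x₀ x₁ ×ˢ Icc y₀ y₁ := by
    rw [closure_prod_eq, closure_Ioo hx.ne, closure_Ioo hy.ne]
  have hclosed : IsClosed (Icc x₀ x₁ ×ˢ Icc y₀ y₁) := isClosed_Icc.prod isClosed_Icc
  have hadd (r : ℝ × ℝ) : Tendsto (fun v => r + v) (𝓝 0) (𝓝 r) := by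
    have : Continuous fun v => r + v := by fun_prop
    simpa only [add_zero] using this.tendsto 0
  have e1 := h.eventually (fun _ _ => Pet.eventually) hclosed
  have e2 : ∀ᶠ v in 𝓝 0, Pet t 1 m (A (p + v)) (q' + (A (p + v) - A p)) := by
    have ht : Tendsto (fun v => A (p + v) - A p) (𝓝 0) (𝓝 0) := by
      have : Continuous fun v => A (p + v) - A p := by fun_prop
      simpa only [add_zero, sub_self] using this.tendsto 0
    filter_upwards [ht.eventually h'.eventually] with v hv
    rwa [add_sub_cancel] at hv
  have hp : p ∈ Ioo x₀ x₁ ×ˢ Ioo y₀ y₁ := by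
    rw [← hint, mem_interior_iff_mem_nhds]
    have : ∀ᶠ r in 𝓝 p, A r ∈ Ioo (0 : ℝ) 1 ×ˢ Ioo 0 t :=
      hAc.continuousAt.eventually ((isOpen_Ioo.prod isOpen_Ioo).mem_nhds h'.left_mem)
    filter_upwards [this] with r hr
    exact (hY r).2 ⟨Ioo_subset_Icc_self hr.1, Ioo_subset_Icc_self hr.2⟩
  have e3 : ∀ᶠ v in 𝓝 0, p + v ∈ Ioo x₀ x₁ ×ˢ Ioo y₀ y₁ :=
    (hadd p).eventually ((isOpen_Ioo.prod isOpen_Ioo).mem_nhds hp)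
  have e4 : ∀ᶠ v in 𝓝 0, A (q + v) ≠ q' + (A (p + v) - A p) := by
    have hc : Continuous fun v => A (q + v) - (q' + (A (p + v) - A p)) := by fun_prop
    have := hc.continuousAt.eventually_ne (x := 0) (y := 0)
      (by simpa [sub_eq_zero] using hne)
    exact this.mono fun v hv => sub_ne_zero.1 hv
  obtain ⟨W, hW, hWo, h0⟩ := eventually_nhds_iff.1 (e1.and (e2.and (e3.and e4)))
  have hq : q ∈ closure (Ioo x₀ x₁ ×ˢ Ioo y₀ y₁) := hcl ▸ h.mem
  have hWq : (fun r => r - q) ⁻¹' W ∈ 𝓝 q :=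
    (hWo.preimage (by fun_prop)).mem_nhds (by simpa using h0)
  -- As `q` may be a boundary point, the perturbation must push it into the open rectangle; this is
  -- an open condition, so density then allows an irregular starting point.
  obtain ⟨r, hr, hrY⟩ := mem_closure_iff_nhds.1 hq _ hWq
  have hopen : IsOpen
      ((fun w => w - p) ⁻¹' W ∩ (fun w => q + (w - p)) ⁻¹' (Ioo x₀ x₁ ×ˢ Ioo y₀ y₁)) :=
    (hWo.preimage (by fun_prop)).inter ((isOpen_Ioo.prod isOpen_Ioo).preimage (by fun_prop))
  obtain ⟨w, hwi, hw, hwY⟩ := (dense_irreg s).exists_mem_open hopen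
    ⟨p + (r - q), by simpa using hr, by simpa using hrY⟩
  obtain ⟨v, rfl⟩ : ∃ v, w = p + v := ⟨w - p, by abel⟩
  simp only [mem_preimage, add_sub_cancel_left] at hw hwY
  obtain ⟨k1, k2, k3, k4⟩ := hW v hw
  obtain ⟨q₁, hq₁, hr₁⟩ := hcore _ k3 hwi
  have hYq : q + v ∈ Icc x₀ x₁ ×ˢ Icc y₀ y₁ :=
    ⟨Ioo_subset_Icc_self hwY.1, Ioo_subset_Icc_self hwY.2⟩
  obtain rfl := Ret.unique (f := Pet s 1 n) (fun _ _ _ => Pet.unique) (k1 hYq) hr₁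
  exact k4 (hq₁.unique k2)

theorem dist_emb (s : ℝ) (p q : ℝ × ℝ) : dist (emb s p) (emb s q) = ‖lin (p - q)‖ := by
  rw [emb_apply, emb_apply, dist_add_left, dist_eq_norm, map_sub]

theorem renormalization_of_coords (hs : 0 < s) (ht : 0 < t) (hx : x₀ < x₁) (hy : y₀ < y₁)
    (A : ℝ × ℝ ≃ ℝ × ℝ) (hAc : Continuous A) {r : ℝ} (hr : 0 < r)
    (hA : ∀ p q, ‖lin (A p - A q)‖ = r * ‖lin (p - q)‖)
    (hY : ∀ p, p ∈ Icc x₀ x₁ ×ˢ Icc y₀ y₁ ↔ A p ∈ Icc (0 : ℝ) 1 ×ˢ Icc 0 t)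
    (hsub : Icc x₀ x₁ ×ˢ Icc y₀ y₁ ⊂ Icc (0 : ℝ) 1 ×ˢ Icc 0 s)
    (hirr : ∀ p ∈ Icc x₀ x₁ ×ˢ Icc y₀ y₁, Irreg s 1 p → p ∈ Ioo x₀ x₁ ×ˢ Ioo y₀ y₁)
    (hcore : ∀ p ∈ Ioo x₀ x₁ ×ˢ Ioo y₀ y₁, Irreg s 1 p →
      ∃ q, Pet t 1 ⌊1 / t⌋ (A p) (A q) ∧
        Ret (Pet s 1 ⌊1 / s⌋) (Icc x₀ x₁ ×ˢ Icc y₀ y₁) p q) :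
    ∃ (Y : Set Plane) (ψ : Plane ≃ᵈ Plane), Y ⊂ X s ∧ ψ '' Y = X t ∧
      (∀ p q q' : Plane, FirstReturn (PETStep s) Y p q → PETStep t (ψ p) q' → q = ψ.symm q') ∧
      (∀ᵐ p ∂(volume.restrict Y),
        (∃ q, FirstReturn (PETStep s) Y p q) ∧ ∃ q', PETStep t (ψ p) q') := by
  let ψ : Plane ≃ᵈ Plane :=
    { (emb s).toEquiv.symm.trans (A.trans (emb t).toEquiv) with
      edist_eq' := by
        refine ⟨⟨r, hr.le⟩, fun h => hr.ne' (congrArg NNReal.toReal h), fun P Q => ?_⟩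
        obtain ⟨p, rfl⟩ := (emb s).surjective P
        obtain ⟨q, rfl⟩ := (emb s).surjective Q
        have e (v : ℝ × ℝ) : ((emb s).toEquiv.symm.trans (A.trans (emb t).toEquiv)) (emb s v) =
          emb t (A v) := by simp
        change edist (((emb s).toEquiv.symm.trans (A.trans (emb t).toEquiv)) (emb s p))
          (((emb s).toEquiv.symm.trans (A.trans (emb t).toEquiv)) (emb s q)) = _
        rw [e, e, edist_dist, edist_dist, dist_emb, dist_emb, hA, ENNReal.ofReal_mul hr.le]
        congr 1
        exact ENNReal.ofReal_eq_coe_nnreal hr.le }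
  have hψ (v : ℝ × ℝ) : ψ (emb s v) = emb t (A v) := by
    change ((emb s).toEquiv.symm.trans (A.trans (emb t).toEquiv)) (emb s v) = _
    simp
  refine ⟨emb s '' (Icc x₀ x₁ ×ˢ Icc y₀ y₁), ψ, ?_, ?_, ?_, ?_⟩
  · rw [X_eq hs]
    exact ((emb s).injective.image_strictMono hsub)
  · rw [X_eq ht, image_image]
    simp only [hψ]
    rw [← image_image (emb t) A]
    congr 1
    ext v
    rw [A.image_eq_preimage_symm, mem_preimage, hY, A.apply_symm_apply]
  · intro P Q Q' h h'
    obtain ⟨p, rfl⟩ := (emb s).surjective P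
    obtain ⟨q, rfl⟩ := (emb s).surjective Q
    obtain ⟨q', rfl⟩ := (emb t).surjective Q'
    rw [hψ, petStep_iff ht] at h'
    rw [← ret_agree hx hy hAc hY hcore ((firstReturn_iff hs).1 h).2 h', ← hψ]
    exact (ψ.symm_apply_apply _).symm
  · have hm : MeasurableSet (emb s '' (Icc x₀ x₁ ×ˢ Icc y₀ y₁)) :=
      ((emb s).isClosedMap _ (isClosed_Icc.prod isClosed_Icc)).measurableSet
    rw [ae_restrict_iff' hm]
    filter_upwards [ae_irreg s] with P hP hPY
    obtain ⟨p, hp, rfl⟩ := hPY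
    rw [Homeomorph.symm_apply_apply] at hP
    obtain ⟨q, hq, hret⟩ := hcore p (hirr p hp hP) hP
    refine ⟨⟨emb s q, (firstReturn_iff hs).2 ⟨hp, hret⟩⟩, emb t (A q), ?_⟩
    rw [hψ]
    exact (petStep_iff ht).2 hq

end Transfer

end TripleLattice

/-! ### The two ranges of the parameter -/

namespace TripleLattice

open MeasureTheory Set

theorem floor_one_div_eq_one {t : ℝ} (h0 : 1 / 2 < t) (h1 : t ≤ 1) : ⌊1 / t⌋ = 1 := by
  have ht : 0 < t := by linarith
  rw [Int.floor_eq_iff]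
  push_cast
  exact ⟨(one_le_div ht).2 h1, by rw [div_lt_iff₀ ht]; linarith⟩

/-- The claim of the renormalization theorem for the parameters `s` and `t`. -/
def Renormalizes (s t : ℝ) : Prop :=
  ∃ (Y : Set Plane) (ψ : Plane ≃ᵈ Plane), Y ⊂ X s ∧ ψ '' Y = X t ∧
    (∀ p q q' : Plane, FirstReturn (PETStep s) Y p q → PETStep t (ψ p) q' → q = ψ.symm q') ∧
    (∀ᵐ p ∂(volume.restrict Y),
      (∃ q, FirstReturn (PETStep s) Y p q) ∧ ∃ q', PETStep t (ψ p) q')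

/-- `Y` is the right part of width `c = 1 - (n - 1) * s`. As `s ≤ c < 2 * s`, the shift number at `s
/ c` is 1. -/
theorem renormalizes_of_le_half {s : ℝ} (hs : 0 < s) (h : s ≤ 1 / 2) :
    Renormalizes s (s / (1 - (⌊1 / s⌋ - 1) * s)) := by
  obtain ⟨n, hn⟩ : ∃ n, n = ⌊1 / s⌋ := ⟨_, rfl⟩
  obtain ⟨c, hc⟩ : ∃ c : ℝ, c = 1 - (n - 1) * s := ⟨_, rfl⟩
  have hn2 : 2 ≤ n := by
    rw [hn, Int.le_floor, le_div_iff₀ hs]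
    push_cast
    linarith
  have hlo : n * s ≤ 1 := (le_div_iff₀ hs).1 (hn ▸ Int.floor_le (1 / s))
  have hhi : 1 < (n + 1) * s := (div_lt_iff₀ hs).1 (hn ▸ Int.lt_floor_add_one (1 / s))
  have hsc : s ≤ c := by linarith
  have hcs : c < 2 * s := by linarith
  have hc0 : 0 < c := by linarith
  have hns : s ≤ (n - 1) * s := by
    have : (2 : ℝ) ≤ n := by exact_mod_cast hn2
    nlinarith
  have ht : ⌊1 / (s / c)⌋ = 1 := floor_one_div_eq_one
    (by rw [div_lt_div_iff₀ two_pos hc0]; linarith) ((div_le_one hc0).2 hsc)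
  rw [← hn, ← hc]
  let A : ℝ × ℝ ≃ ℝ × ℝ :=
    { toFun := fun p => c⁻¹ • (p.1 - (n - 1) * s, p.2)
      invFun := fun v => (c * v.1 + (n - 1) * s, c * v.2)
      left_inv := fun p => by ext <;> simp [hc0.ne']
      right_inv := fun v => by ext <;> simp [hc0.ne'] }
  have hA (p : ℝ × ℝ) : A p = c⁻¹ • (p.1 - (n - 1) * s, p.2) := rfl
  refine renormalization_of_coords (x₀ := (n - 1) * s) (x₁ := 1) (y₀ := 0) (y₁ := s) (r := c⁻¹)
    hs (div_pos hs hc0) (by linarith) hs A ?_ (inv_pos.2 hc0) ?_ ?_ ?_ ?_ ?_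
  · change Continuous fun p : ℝ × ℝ => c⁻¹ • (p.1 - (n - 1) * s, p.2)
    fun_prop
  · intro p q
    rw [hA, hA, ← smul_sub, map_smul, norm_smul, Real.norm_of_nonneg (inv_pos.2 hc0).le]
    congr 3
    ext <;> simp
  · have hdiv (y : ℝ) : 0 ≤ y / c ↔ 0 ≤ y := by rw [le_div_iff₀ hc0, zero_mul]
    rintro ⟨x, y⟩
    simp only [hA, mem_prod, mem_Icc, Prod.smul_mk, smul_eq_mul, ← div_eq_inv_mul,
      hdiv, div_le_one hc0, div_le_div_iff_of_pos_right hc0]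
    refine and_congr_left fun _ => and_congr ?_ ?_ <;> constructor <;> intro _ <;> linarith
  · refine ⟨fun p hp => ⟨⟨by linarith [hp.1.1], hp.1.2⟩, hp.2⟩, fun hsub => ?_⟩
    have h0 : ((0 : ℝ), (0 : ℝ)) ∈ Icc (0 : ℝ) 1 ×ˢ Icc 0 s := by simp [hs.le]
    have := (hsub h0).1.1
    dsimp only at this
    linarith
  · rintro p ⟨h1, h2⟩ ⟨hx, hy, -⟩
    refine ⟨⟨h1.1.lt_of_ne' fun e => hx (n - 1) 0 ?_, h1.2.lt_of_ne fun e => hx 0 1 ?_⟩,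
      h2.1.lt_of_ne' fun e => hy 0 0 ?_, h2.2.lt_of_ne fun e => hy 1 0 ?_⟩ <;>
    rw [e] <;> push_cast <;> ring
  · rintro ⟨x, y⟩ ⟨h1, h2⟩ ⟨hx, hy, hxy⟩
    dsimp only at h1 h2 hx hy hxy
    obtain ⟨q, hq⟩ := step_total (a := s) (b := c) (p := (x - (n - 1) * s, y))
      ⟨⟨by linarith [h1.1], by linarith [h1.2]⟩, h2⟩
      ⟨fun i j e => hx (i + (n - 1) * (1 - j)) j (by push_cast; dsimp only at e; rw [hc] at e; linarith),
       fun i j e => hy (i - (n - 1) * j) j (by push_cast; dsimp only at e; rw [hc] at e; linarith),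
       fun i j e => hxy (i + (n - 1) * (1 - j)) j (by push_cast; dsimp only at e; rw [hc] at e; linarith)⟩
    refine ⟨(q.1 + (n - 1) * s, q.2), ?_, ?_⟩
    · have := (hq.pet hsc hcs.le).smul (inv_pos.2 hc0)
      rw [inv_mul_cancel₀ hc0.ne', ← div_eq_inv_mul] at this
      rw [hA, hA, ht]
      simpa using this
    · have := ret_of_step_cut hs hn2 hlo hhi (hc ▸ hq)
      simp only [sub_add_cancel] at this
      rw [← hn]
      refine this.congr fun p r hr => ?_
      have hm := hr.right_mem
      simp only [mem_ofPred_eq, mem_prod, mem_Icc, hm.1.2.le, hm.2.1.le, hm.2.2.le, and_self,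
        and_true]

/-- `Y` is the upper left corner of sides `1 - s` and `c`, where `c` is what remains of `s` after
`j` gluings. The similarity reverses orientation. -/
theorem renormalizes_of_half_lt {s : ℝ} (h : 1 / 2 < s) (hs1 : s < 1) :
    Renormalizes s ((1 - s) / (1 - ⌊s / (1 - s)⌋ * (1 - s))) := by
  have hs : 0 < s := by linarith
  have hε : 0 < 1 - s := by linarith
  obtain ⟨m, hm⟩ : ∃ m, m = ⌊s / (1 - s)⌋ := ⟨_, rfl⟩
  have hlo : m * (1 - s) ≤ s := (le_div_iff₀ hε).1 (hm ▸ Int.floor_le (s / (1 - s)))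
  have hhi : s < (m + 1) * (1 - s) := (div_lt_iff₀ hε).1 (hm ▸ Int.lt_floor_add_one (s / (1 - s)))
  have hm1 : 1 ≤ m := by
    rw [hm, Int.le_floor, le_div_iff₀ hε]
    push_cast
    linarith
  obtain ⟨j, hj⟩ := Int.eq_ofNat_of_zero_le (sub_nonneg.2 hm1)
  obtain rfl : m = j + 1 := by omega
  push_cast at hlo hhi
  obtain ⟨c, hc⟩ : ∃ c : ℝ, c = s - j * (1 - s) := ⟨_, rfl⟩
  have hεc : 1 - s ≤ c := by linarith
  have hcε : c < 2 * (1 - s) := by linarith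
  have hc0 : 0 < c := by linarith
  have hcs : c ≤ s := by
    have : 0 ≤ j * (1 - s) := by positivity
    linarith
  have hF : FlipRet s 1 c := hc ▸ flipRet_sub_mul j hs1 (by linarith) (by linarith)
  have ht : ⌊1 / ((1 - s) / c)⌋ = 1 := floor_one_div_eq_one
    (by rw [div_lt_div_iff₀ two_pos hc0]; linarith) ((div_le_one hc0).2 hεc)
  have hcd : 1 - ⌊s / (1 - s)⌋ * (1 - s) = c := by
    rw [← hm, hc]
    push_cast
    ring
  rw [hcd]
  let A : ℝ × ℝ ≃ ℝ × ℝ :=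
    { toFun := fun p => c⁻¹ • (s - p.2, 1 - s - p.1)
      invFun := fun v => (1 - s - c * v.2, s - c * v.1)
      left_inv := fun p => by ext <;> simp [hc0.ne']
      right_inv := fun v => by ext <;> simp [hc0.ne'] }
  have hA (p : ℝ × ℝ) : A p = c⁻¹ • (s - p.2, 1 - s - p.1) := rfl
  refine renormalization_of_coords (x₀ := 0) (x₁ := 1 - s) (y₀ := s - c) (y₁ := s) (r := c⁻¹)
    hs (div_pos hε hc0) hε (by linarith) A ?_ (inv_pos.2 hc0) ?_ ?_ ?_ ?_ ?_
  · change Continuous fun p : ℝ × ℝ => c⁻¹ • (s - p.2, 1 - s - p.1)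
    fun_prop
  · intro p q
    rw [hA, hA, ← smul_sub, map_smul, norm_smul, Real.norm_of_nonneg (inv_pos.2 hc0).le]
    congr 1
    -- Exchanging and negating the coordinates preserves the form x² + xy + y².
    rw [← sq_eq_sq₀ (norm_nonneg _) (norm_nonneg _), norm_lin_sq, norm_lin_sq]
    simp only [Prod.fst_sub, Prod.snd_sub]
    ring
  · have hdiv (y : ℝ) : 0 ≤ y / c ↔ 0 ≤ y := by rw [le_div_iff₀ hc0, zero_mul]
    rintro ⟨x, y⟩
    simp only [hA, mem_prod, mem_Icc, Prod.smul_mk, smul_eq_mul, ← div_eq_inv_mul,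
      hdiv, div_le_one hc0, div_le_div_iff_of_pos_right hc0]
    constructor <;> rintro ⟨⟨_, _⟩, _, _⟩ <;> refine ⟨⟨?_, ?_⟩, ?_, ?_⟩ <;> linarith
  · refine ⟨fun p hp => ⟨⟨hp.1.1, by linarith [hp.1.2]⟩, by linarith [hp.2.1], hp.2.2⟩,
      fun hsub => ?_⟩
    have h0 : ((1 : ℝ), s) ∈ Icc (0 : ℝ) 1 ×ˢ Icc 0 s := by simp [hs.le]
    have := (hsub h0).1.2
    dsimp only at this
    linarith
  · rintro p ⟨h1, h2⟩ ⟨hx, hy, -⟩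
    refine ⟨⟨h1.1.lt_of_ne' fun e => hx 0 0 ?_, h1.2.lt_of_ne fun e => hx (-1) 1 ?_⟩,
      h2.1.lt_of_ne' fun e => hy (-j) j ?_, h2.2.lt_of_ne fun e => hy 1 0 ?_⟩ <;>
    rw [e] <;> push_cast <;> linarith
  · rintro ⟨x, y⟩ ⟨h1, h2⟩ hi
    dsimp only at h1 h2
    obtain ⟨q, hq, hret⟩ := hF (x, y) ⟨⟨h1.1, by linarith [h1.2]⟩, by linarith [h2.1], h2.2⟩ hi
      h1.2 h2.1
    refine ⟨q, ?_, ?_⟩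
    · have := (hq.pet hεc hcε.le).smul (inv_pos.2 hc0)
      rw [inv_mul_cancel₀ hc0.ne', ← div_eq_inv_mul] at this
      rwa [hA, hA, ht]
    · rw [floor_one_div_eq_one h hs1.le]
      refine (hret.mono_rel fun _ _ hr => hr.pet hs1.le (by linarith)).congr fun p r hr => ?_
      have hm := hr.right_mem
      simp only [mem_ofPred_eq, mem_prod, mem_Icc, hm.1.1.le, hm.2.2.le, true_and, and_true]

theorem R_of_le_half {s : ℝ} (hs : 0 < s) (h : s ≤ 1 / 2) :
    R s = s / (1 - (⌊1 / s⌋ - 1) * s) := by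
  rcases h.lt_or_eq with h | rfl
  · rw [R, if_pos h, R₁]
    congr 1
    ring
  -- At 1/2 the definition uses `R₂`; both formulas give 1.
  · norm_num [R, R₂]

/-- One formula covers both branches, because ⌊s/(1-s)⌋ = 1 for 1/2 < s < 2/3. -/
theorem R_of_half_lt {s : ℝ} (h : 1 / 2 < s) (hs1 : s < 1) :
    R s = (1 - s) / (1 - ⌊s / (1 - s)⌋ * (1 - s)) := by
  have hs : 0 < s := by linarith
  have hε : 0 < 1 - s := by linarith
  rw [R, if_neg h.not_gt]
  split_ifs with h2
  · have : ⌊s / (1 - s)⌋ = 1 := by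
      rw [Int.floor_eq_iff]
      push_cast
      exact ⟨(one_le_div hε).2 (by linarith), by rw [div_lt_iff₀ hε]; linarith⟩
    rw [this, R₂]
    push_cast
    ring_nf
  · rw [R₁, R₂, one_div_div]
    have : 1 + (1 - s) / s - (1 - s) / s * ⌊s / (1 - s)⌋ =
        (1 - ⌊s / (1 - s)⌋ * (1 - s)) / s := by
      field_simp
      ring
    rw [this, div_div_div_cancel_right₀ hs.ne']

end TripleLattice

theorem mainTheorem1 (s : ℝ) (hs0 : 0 < s) (hs1 : s < 1) :
    ∃ (Y : Set TripleLattice.Plane) (ψ : TripleLattice.Plane ≃ᵈ TripleLattice.Plane),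
      Y ⊂ TripleLattice.X s ∧
      ψ '' Y = TripleLattice.X (TripleLattice.R s) ∧
      (∀ p q q' : TripleLattice.Plane,
        TripleLattice.FirstReturn (TripleLattice.PETStep s) Y p q →
        TripleLattice.PETStep (TripleLattice.R s) (ψ p) q' → q = ψ.symm q') ∧
      (∀ᵐ p ∂(MeasureTheory.volume.restrict Y),
        (∃ q, TripleLattice.FirstReturn (TripleLattice.PETStep s) Y p q) ∧
        ∃ q', TripleLattice.PETStep (TripleLattice.R s) (ψ p) q') := by
  rcases le_or_gt s (1 / 2) with h | h
  · rw [TripleLattice.R_of_le_half hs0 h]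
    exact TripleLattice.renormalizes_of_le_half hs0 h
  · rw [TripleLattice.R_of_half_lt h hs1]
    exact TripleLattice.renormalizes_of_half_lt h hs1
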